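/- Let $G=(V,E)$ be a finite simple graph. For $u\in V$ let $X_u$ and $Z_u$ be the Pauli $X$ and $Z$ operators acting on the qubit $u$ of a register of qubits indexed by $V$ (so they are complex $2^{|V|}\times 2^{|V|}$ matrices), and put $H_m=\sum_{u\in V}X_u$ and $H_p=\sum_{(u,v)\in E}Z_uZ_v$. The QAOA-MaxCut dynamical Lie algebra (DLA) $\mathfrak g_G$ is the real Lie algebra of matrices (with the commutator as bracket) generated by $\{\mathrm i H_p,\mathrm i H_m\}$, and the multi-angle DLA $\mathfrak g_{G,\mathrm{ma}}$ is the one generated by $\{\mathrm i X_u : u\in V\}\cup\{\mathrm i Z_uZ_v : (u,v)\in E\}$. The DLA of $G$ is called free if $\mathfrak g_G=\mathfrak g_{G,\mathrm{ma}}$. The DLA of $G$ is free in each of the following cases. (i) $G$ is an asymmetric subdivision of an odd graph. Here an odd graph is a finite simple connected graph on at least $3$ vertices all of whose degrees are odd. A subdivision of a graph $H$ is obtained by choosing a set $\hat E\subseteq E(H)$ and replacing each edge $(u,v)\in\hat E$ by a path from $u$ to $v$ with $\ell_{uv}\ge 1$ new interior vertices; it is asymmetric if $|E(H)\setminus\hat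 E|\le 1$ and the numbers $\ell_{uv}$, $(u,v)\in\hat E$, are pairwise distinct. (ii) $G=G_{n,1}$ or $G=G_{n,2}$ with $n\ge 3$, where the extended ladder graph $G_{n,k}$ has the $2n+k$ vertices $u_{-k},\dots,u_{n-1},v_0,\dots,v_{n-1}$ and the edges $(u_i,v_i)$ for $0\le i\le n-1$, $(u_i,u_{i+1})$ for $-k\le i\le n-2$, and $(v_i,v_{i+1})$ for $0\le i\le n-2$. (iii) $G=G(w,h)$ with $w>h\ge 3$, where the grid+1 graph $G(w,h)$ has the vertices $u_{i,j}$ for $0\le i\le w$, $0\le j\le h$, and one more vertex $u_{-1,0}$, and the edges $(u_{-1,0},u_{0,0})$, $(u_{i,j},u_{i+1,j})$ for $0\le i\le w-1$, $0\le j\le h$, and $(u_{i,j},u_{i,j+1})$ for $0\le i\le w$, $0\le j\le h-1$. -/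

import Mathlib

namespace QAOA

noncomputable section

/-- Operators on the qubit register indexed by `V`: complex matrices whose rows and columns are
indexed by the computational basis states `V → Fin 2`. -/
abbrev Operator (V : Type*) : Type _ := Matrix (V → Fin 2) (V → Fin 2) ℂ

/-- The Pauli matrix `X` of a single qubit. -/
def pauliX : Matrix (Fin 2) (Fin 2) ℂ := !![0, 1; 1, 0]

/-- The Pauli matrix `Z` of a single qubit. -/
def pauliZ : Matrix (Fin 2) (Fin 2) ℂ := !![1, 0; 0, -1]

/-! The Lie bracket of operators is the commutator `⁅A, B⁆ = A * B - B * A`. -/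

attribute [local instance 100] LieRing.ofAssociativeRing

variable {V : Type*} [Fintype V] [DecidableEq V]

/-- The tensor product over all qubits with factor `P` at the qubit `u` and the identity at all
other qubits; the entries of a tensor product are the products of the entries of the factors. -/
def onQubit (P : Matrix (Fin 2) (Fin 2) ℂ) (u : V) : Operator V :=
  Matrix.of fun x y => ∏ v, (if v = u then P else 1) (x v) (y v)

/-- The Pauli operator `X_u`. -/
def X (u : V) : Operator V := onQubit pauliX u

/-- The Pauli operator `Z_u`. -/
def Z (u : V) : Operator V := onQubit pauliZ u

theorem Z_eq_diagonal (u : V) :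
    (Z u : Operator V) = Matrix.diagonal fun x => pauliZ (x u) (x u) := by
  ext x y
  by_cases hxy : x = y
  · subst hxy
    rw [Matrix.diagonal_apply_eq, Z, onQubit, Matrix.of_apply, Finset.prod_eq_single u]
    · simp
    · intro v _ hv
      simp [hv]
    · simp
  · rw [Matrix.diagonal_apply_ne _ hxy, Z, onQubit, Matrix.of_apply]
    obtain ⟨v, hv⟩ := Function.ne_iff.mp hxy
    refine Finset.prod_eq_zero (Finset.mem_univ v) ?_
    by_cases hvu : v = u
    · rw [if_pos hvu]
      generalize x v = a at hv
      generalize y v = b at hv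
      fin_cases a <;> fin_cases b <;> simp_all [pauliZ]
    · rw [if_neg hvu, Matrix.one_apply_ne hv]

theorem Z_mul_comm (u v : V) : (Z u * Z v : Operator V) = Z v * Z u := by
  simp only [Z_eq_diagonal, Matrix.diagonal_mul_diagonal, mul_comm]

/-- The operator `Z_u Z_v` of an unordered pair `{u, v}`. -/
def ZZ (e : Sym2 V) : Operator V :=
  Sym2.lift ⟨fun u v => Z u * Z v, Z_mul_comm⟩ e

/-- The mixer Hamiltonian `H_m = ∑_{u ∈ V} X_u`. -/
def mixerHamiltonian (V : Type*) [Fintype V] [DecidableEq V] : Operator V := ∑ u, X u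

open Classical in
/-- The problem Hamiltonian `H_p = ∑_{(u,v) ∈ E} Z_u Z_v`, one summand for each edge. -/
def problemHamiltonian (G : SimpleGraph V) : Operator V := ∑ e ∈ G.edgeFinset, ZZ e

/-- The standard QAOA-MaxCut dynamical Lie algebra: the real Lie algebra of matrices, with the
commutator as bracket, generated by `i H_p` and `i H_m`. -/
def dla (G : SimpleGraph V) : LieSubalgebra ℝ (Operator V) :=
  LieSubalgebra.lieSpan ℝ (Operator V)
    {Complex.I • problemHamiltonian G, Complex.I • mixerHamiltonian V}

/-- The multi-angle QAOA-MaxCut dynamical Lie algebra: the real Lie algebra of matrices generated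
by all `i X_u`, `u ∈ V`, and all `i Z_u Z_v`, `(u, v) ∈ E`. -/
def multiAngleDLA (G : SimpleGraph V) : LieSubalgebra ℝ (Operator V) :=
  LieSubalgebra.lieSpan ℝ (Operator V)
    ({A | ∃ u : V, A = Complex.I • X u} ∪
      {A | ∃ u v : V, G.Adj u v ∧ A = Complex.I • (Z u * Z v)})

/-- The QAOA-MaxCut DLA of `G` is free: it equals the multi-angle DLA. -/
def IsFree (G : SimpleGraph V) : Prop := dla G = multiAngleDLA G

end

/-! ### Asymmetric subdivisions of odd graphs -/

/-- An odd graph: a connected graph on at least three vertices, all of whose degrees are odd. -/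
def IsOddGraph {W : Type*} [Fintype W] (H : SimpleGraph W) : Prop :=
  H.Connected ∧ 3 ≤ Fintype.card W ∧ ∀ v, Odd (H.neighborSet v).ncard

/-- The data of a subdivision of `H`: for each edge `e` an ordering `(src e, tgt e)` of its two ends
and the number `len e` of new vertices placed on it; `len e = 0` means that `e` is kept. -/
structure Subdivision {W : Type*} (H : SimpleGraph W) where
  src : H.edgeSet → W
  tgt : H.edgeSet → W
  ends : ∀ e, s(src e, tgt e) = (e : Sym2 W)
  len : H.edgeSet → ℕ

namespace Subdivision

variable {W : Type*} {H : SimpleGraph W} (D : Subdivision H)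

/-- The vertices of the subdivided graph: those of `H`, and `len e` new ones on each edge `e`. -/
abbrev Vertex : Type _ := W ⊕ Σ e : H.edgeSet, Fin (D.len e)

/-- The vertices `src e, w_e^1, …, w_e^ℓ, tgt e`, where `ℓ = len e`, of the path that replaces the
edge `e`, numbered by `0, 1, …, ℓ, ℓ + 1`. -/
def pathVertex (e : H.edgeSet) : ℕ → D.Vertex
  | 0 => Sum.inl (D.src e)
  | j + 1 => if h : j < D.len e then Sum.inr ⟨e, ⟨j, h⟩⟩ else Sum.inl (D.tgt e)

/-- The subdivided graph: its edges join consecutive vertices of the paths that replace the edges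
of `H` (if `len e = 0`, this path is the edge `e` itself). -/
def graph : SimpleGraph D.Vertex :=
  SimpleGraph.fromEdgeSet
    {d | ∃ e, ∃ i ≤ D.len e, d = s(D.pathVertex e i, D.pathVertex e (i + 1))}

/-- The set of edges that are really subdivided. -/
def subdivided : Set H.edgeSet := {e | 1 ≤ D.len e}

/-- At most one edge is not subdivided, and distinct subdivided edges receive different numbers of
new vertices. -/
def IsAsymmetric : Prop := (D.subdividedᶜ).encard ≤ 1 ∧ Set.InjOn D.len D.subdivided

end Subdivision

/-- `G` is (isomorphic to) an asymmetric subdivision of `H`. -/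
def IsAsymmetricSubdivision {V W : Type*} (G : SimpleGraph V) (H : SimpleGraph W) : Prop :=
  ∃ D : Subdivision H, D.IsAsymmetric ∧ Nonempty (G ≃g D.graph)

/-! ### Extended ladder graphs and grid+1 graphs -/

/-- The `(n, k)`-extended ladder graph with vertices `u_{-k}, …, u_{n-1}` and `v_0, …, v_{n-1}`.
Here `Sum.inl a` is `u_{a-k}` and `Sum.inr i` is `v_i`. -/
def extendedLadder (n k : ℕ) : SimpleGraph (Fin (n + k) ⊕ Fin n) :=
  SimpleGraph.fromRel fun
    | Sum.inl a, Sum.inl b => (a : ℕ) + 1 = b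
    | Sum.inr i, Sum.inr j => (i : ℕ) + 1 = j
    | Sum.inl a, Sum.inr i => (a : ℕ) = i + k
    | Sum.inr _, Sum.inl _ => False

/-- The `(w, h)`-grid+1 graph. Here `some (i, j)` is the grid vertex `u_{i,j}`, `0 ≤ i ≤ w`,
`0 ≤ j ≤ h`, and `none` is the additional vertex `u_{-1,0}`, which is attached to `u_{0,0}`. -/
def gridPlusOne (w h : ℕ) : SimpleGraph (Option (Fin (w + 1) × Fin (h + 1))) :=
  SimpleGraph.fromRel fun
    | none, some p => p = (0, 0)
    | some p, some q =>
        ((p.1 : ℕ) + 1 = q.1 ∧ p.2 = q.2) ∨ (p.1 = q.1 ∧ (p.2 : ℕ) + 1 = q.2)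
    | _, none => False

end QAOA

/-! Two operations split the generators inside any real Lie algebra `g` containing `i ∑_{u ∈ P} X_u`
and `i ∑_{e ∈ S} Z_u Z_v`. First, the double commutator with `∑_{u ∈ P} X_u` has eigenvalue 4 on
edges with exactly one end in `P`, and only eigenvalues 0 and 16 on the span generated from any
other edge; hence a polynomial in it isolates `S ∩ cut P` (`zzSum_inter_cut_mem`). Second, the edge
sum is diagonal, and flipping qubit `u` changes its eigenvalue by `2m`, with `m` of the same parity
as the `S`-degree of `u`; hence a polynomial in the double commutator with the edge sum isolates the
vertices of `P` of odd `S`-degree (`xSum_odd_mem`).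

Take a minimal equivalence relation on `V` whose class sums of `i X_u` all lie in the DLA. The two
operations would refine it unless equivalent vertices have, mod 2, equally many neighbours in every
class. So if equality is the only such relation (`IsParityRigid`), every `i X_u` lies in the DLA;
cuts by single vertices then isolate every `i Z_u Z_v`, and the DLA is free
(`IsParityRigid.isFree`).

Freeness thus becomes combinatorics. For a parity-equitable relation, unions of classes are closed
under Boolean operations and under `oddNeighbors` (`IsSaturated.oddNeighbors`). In each family all
singletons are obtained from the whole vertex set by these operations: the parity of the degrees
gives a first landmark, an asymmetry of the graph singles out a vertex, and the rest is reached by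
propagation. -/

namespace QAOA

/-! ### Pauli operators as tensor products, and their commutators -/

section

attribute [local instance 100] LieRing.ofAssociativeRing

variable {V : Type*} [Fintype V] [DecidableEq V]

/-- The tensor product of a family of one-qubit matrices. -/
def tensor (A : V → Matrix (Fin 2) (Fin 2) ℂ) : Operator V :=
  Matrix.of fun x y => ∏ v, A v (x v) (y v)

theorem tensor_mul (A B : V → Matrix (Fin 2) (Fin 2) ℂ) :
    tensor A * tensor B = tensor (A * B) := by
  ext x y
  simp only [tensor, Matrix.mul_apply, Matrix.of_apply, Pi.mul_apply, Finset.prod_univ_sum,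
    Fintype.piFinset_univ, Finset.prod_mul_distrib]

theorem onQubit_eq_tensor (P : Matrix (Fin 2) (Fin 2) ℂ) (u : V) :
    onQubit P u = tensor fun v => if v = u then P else 1 := rfl

theorem onQubit_mul (P Q : Matrix (Fin 2) (Fin 2) ℂ) (u : V) :
    onQubit P u * onQubit Q u = onQubit (P * Q) u := by
  simp only [onQubit_eq_tensor, tensor_mul]
  congr 1
  funext v
  by_cases h : v = u <;> simp [h]

theorem onQubit_commute (P Q : Matrix (Fin 2) (Fin 2) ℂ) {u v : V} (huv : u ≠ v) :
    Commute (onQubit P u) (onQubit Q v) := by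
  simp only [Commute, SemiconjBy, onQubit_eq_tensor, tensor_mul]
  congr 1
  funext w
  by_cases hu : w = u
  · subst hu; simp [huv]
  · simp [hu]

theorem onQubit_one (u : V) : onQubit 1 u = (1 : Operator V) := by
  ext x y
  simp only [onQubit, Matrix.of_apply, ite_self]
  by_cases h : x = y
  · subst h; simp only [Matrix.one_apply_eq, Finset.prod_const_one]
  · obtain ⟨v, hv⟩ := Function.ne_iff.mp h
    rw [Matrix.one_apply_ne h]
    exact Finset.prod_eq_zero (Finset.mem_univ v) (Matrix.one_apply_ne hv)

theorem onQubit_neg (P : Matrix (Fin 2) (Fin 2) ℂ) (u : V) : onQubit (-P) u = -onQubit P u := by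
  ext x y
  simp only [onQubit, Matrix.of_apply, Matrix.neg_apply]
  rw [← Finset.mul_prod_erase _ _ (Finset.mem_univ u),
    ← Finset.mul_prod_erase _ _ (Finset.mem_univ u), ← neg_mul]
  congr 1
  · simp
  · refine Finset.prod_congr rfl fun v hv => ?_
    simp [(Finset.mem_erase.mp hv).1]

theorem X_mul_self (u : V) : X u * X u = (1 : Operator V) := by
  rw [X, onQubit_mul, ← onQubit_one u]
  congr 1
  ext i j
  fin_cases i <;> fin_cases j <;> simp [pauliX]

/-- The operator `X_u Z_u`. -/
noncomputable def XZ (u : V) : Operator V := X u * Z u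

theorem Z_mul_X (u : V) : (Z u * X u : Operator V) = -(X u * Z u) := by
  rw [X, Z, onQubit_mul, onQubit_mul, ← onQubit_neg]
  congr 1
  ext i j
  fin_cases i <;> fin_cases j <;> simp [pauliX, pauliZ]

/-- The sum of the operators `X_u`, `u ∈ P`. -/
noncomputable def xSum (P : Set V) : Operator V := ∑ u, P.indicator X u

/-- The sum of the operators `Z_u Z_v`, `{u, v} ∈ S`. -/
noncomputable def zzSum (S : Set (Sym2 V)) : Operator V := ∑ e, S.indicator ZZ e

theorem xSum_add_xSum_diff {P Q : Set V} (h : Q ⊆ P) : xSum Q + xSum (P \ Q) = xSum P := by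
  simp only [xSum, ← Finset.sum_add_distrib]
  refine Finset.sum_congr rfl fun u _ => ?_
  by_cases hQ : u ∈ Q
  · simp [hQ, h hQ]
  · by_cases hP : u ∈ P <;> simp [hQ, hP]

theorem zzSum_add_zzSum_diff {S T : Set (Sym2 V)} (h : T ⊆ S) :
    zzSum T + zzSum (S \ T) = zzSum S := by
  simp only [zzSum, ← Finset.sum_add_distrib]
  refine Finset.sum_congr rfl fun e _ => ?_
  by_cases hT : e ∈ T
  · simp [hT, h hT]
  · by_cases hS : e ∈ S <;> simp [hT, hS]

theorem xSum_singleton (u : V) : xSum {u} = X u := by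
  classical
  rw [xSum, Finset.sum_eq_single u]
  · simp
  · intro v _ hv; simp [hv]
  · simp

theorem zzSum_singleton (e : Sym2 V) : zzSum {e} = ZZ e := by
  classical
  rw [zzSum, Finset.sum_eq_single e]
  · simp
  · intro v _ hv; simp [hv]
  · simp

theorem lie_X_of_ne {A : Operator V} {u : V} {P : Set V} (h : ∀ v, v ≠ u → ⁅X v, A⁆ = 0) :
    ⁅xSum P, A⁆ = P.indicator (fun v => ⁅X v, A⁆) u := by
  classical
  rw [xSum, sum_lie, Finset.sum_eq_single u]
  · by_cases hu : u ∈ P <;> simp [hu]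
  · intro v _ hv
    by_cases hP : v ∈ P <;> simp [hP, h v hv]
  · simp

open Classical in
theorem lie_xSum_Z (P : Set V) (u : V) :
    ⁅xSum P, (Z u : Operator V)⁆ = (if u ∈ P then 2 else 0 : ℂ) • XZ u := by
  rw [lie_X_of_ne (u := u) (P := P) (A := Z u) fun v hv => (onQubit_commute _ _ hv).lie_eq]
  by_cases hu : u ∈ P
  · simp [hu, Ring.lie_def, Z_mul_X, two_smul, XZ]
  · simp [hu]

open Classical in
theorem lie_xSum_XZ (P : Set V) (u : V) :
    ⁅xSum P, (XZ u : Operator V)⁆ = (if u ∈ P then 2 else 0 : ℂ) • Z u := by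
  rw [lie_X_of_ne (u := u) (P := P) (A := XZ u) fun v hv =>
    ((onQubit_commute _ _ hv).mul_right (onQubit_commute _ _ hv)).lie_eq]
  by_cases hu : u ∈ P
  · simp only [hu, Set.indicator_of_mem, Ring.lie_def, XZ, if_true, two_smul]
    rw [← mul_assoc, X_mul_self, mul_assoc, Z_mul_X, mul_neg, ← mul_assoc, X_mul_self]
    simp
  · simp [hu]

theorem lie_mul_eq (A B C : Operator V) : ⁅A, B * C⁆ = ⁅A, B⁆ * C + B * ⁅A, C⁆ := by
  simp only [Ring.lie_def]
  noncomm_ring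

/-! ### Separating edges by cuts -/

/-- The edges with exactly one end in `P`. -/
def cut (P : Set V) : Set (Sym2 V) := {e | ∃ u ∈ P, ∃ v ∉ P, e = s(u, v)}

theorem mk_mem_cut {U : Type*} {P : Set U} {u v : U} : s(u, v) ∈ cut P ↔ ¬(u ∈ P ↔ v ∈ P) := by
  constructor
  · rintro ⟨a, ha, b, hb, h⟩
    rcases Sym2.eq_iff.mp h with ⟨rfl, rfl⟩ | ⟨rfl, rfl⟩ <;> tauto
  · intro h
    by_cases hu : u ∈ P
    · exact ⟨u, hu, v, by tauto, rfl⟩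
    · exact ⟨v, by tauto, u, hu, Sym2.eq_swap⟩

/-- Bracketing with `X_u` swaps `Z_u` and `X_u Z_u` up to a factor 2, so it has eigenvalues `±2` on
their span. The square of the bracket with `xSum P` is therefore 4 on a cut edge, 0 if both ends lie
outside `P`, and has eigenvalues 0 and 16 if both lie inside. The polynomial `t² - 16t` kills 0 and
16 and takes the value `-48` at 4. -/
theorem lie_xSum_four_ZZ (P : Set V) {e : Sym2 V} :
    ⁅xSum P, ⁅xSum P, ⁅xSum P, ⁅xSum P, ZZ e⁆⁆⁆⁆ - (16 : ℂ) • ⁅xSum P, ⁅xSum P, ZZ e⁆⁆ =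
      (-48 : ℂ) • (cut P).indicator ZZ e := by
  classical
  induction e with | _ u v
  have hZZ : ZZ s(u, v) = (Z u * Z v : Operator V) := rfl
  by_cases hc : s(u, v) ∈ cut P
  · rw [Set.indicator_of_mem hc]
    rw [mk_mem_cut] at hc
    rw [hZZ]
    by_cases hu : u ∈ P
    · have hv : v ∉ P := by tauto
      simp only [lie_mul_eq, lie_xSum_Z, lie_xSum_XZ, hu, hv, if_true, if_false, zero_smul,
        mul_zero, add_zero, smul_mul_assoc, lie_smul, smul_smul, ← sub_smul]
      norm_num
    · have hv : v ∈ P := by tauto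
      simp only [lie_mul_eq, lie_xSum_Z, lie_xSum_XZ, hu, hv, if_true, if_false, zero_smul,
        zero_mul, zero_add, mul_smul_comm, lie_smul, smul_smul, ← sub_smul]
      norm_num
  · rw [Set.indicator_of_notMem hc]
    rw [mk_mem_cut, not_not] at hc
    rw [hZZ]
    by_cases hu : u ∈ P
    · have hv : v ∈ P := by tauto
      simp only [lie_mul_eq, lie_xSum_Z, lie_xSum_XZ, hu, hv, if_true, smul_mul_assoc,
        mul_smul_comm, lie_smul, lie_add]
      module
    · have hv : v ∉ P := by tauto
      simp [lie_mul_eq, lie_xSum_Z, hu, hv]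

theorem lie_xSum_four_zzSum (P : Set V) (S : Set (Sym2 V)) :
    ⁅xSum P, ⁅xSum P, ⁅xSum P, ⁅xSum P, zzSum S⁆⁆⁆⁆ - (16 : ℂ) • ⁅xSum P, ⁅xSum P, zzSum S⁆⁆ =
      (-48 : ℂ) • zzSum (S ∩ cut P) := by
  simp only [zzSum, lie_sum, Finset.smul_sum, ← Finset.sum_sub_distrib]
  refine Finset.sum_congr rfl fun e _ => ?_
  by_cases he : e ∈ S
  · rw [Set.indicator_of_mem he, lie_xSum_four_ZZ]
    by_cases hc : e ∈ cut P <;> simp [he, hc]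
  · have : e ∉ S ∩ cut P := fun h => he h.1
    simp [he, this]

/-- Splitting off the edges with exactly one end in a set of vertices. -/
theorem zzSum_inter_cut_mem {g : LieSubalgebra ℝ (Operator V)} {P : Set V} {S : Set (Sym2 V)}
    (hP : Complex.I • xSum P ∈ g) (hS : Complex.I • zzSum S ∈ g) :
    Complex.I • zzSum (S ∩ cut P) ∈ g := by
  have h2 := g.lie_mem hP (g.lie_mem hP hS)
  have h4 := g.lie_mem hP (g.lie_mem hP h2)
  -- Each bracket with `i • xSum P` contributes a factor `i`, so the double bracket changes sign and
  -- the fourfold one does not; this turns `-16` into `+16`.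
  have key := g.smul_mem (-1 / 48) (g.add_mem h4 (g.smul_mem 16 h2))
  convert key using 1
  have h := congrArg (fun A => (-Complex.I / 48) • A) (lie_xSum_four_zzSum P S)
  simp only [smul_smul] at h
  simp only [lie_smul, smul_lie, smul_smul]
  rw [show Complex.I = -Complex.I / 48 * -48 by ring, ← h]
  simp only [← Complex.coe_smul, smul_add, smul_smul, sub_eq_add_neg, ← neg_smul]
  have hI := Complex.I_sq
  congr 1
  · congr 1
    push_cast
    grind
  · congr 1
    push_cast
    grind

theorem zzSum_diff_cut_mem {g : LieSubalgebra ℝ (Operator V)} {P : Set V} {S : Set (Sym2 V)}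
    (hP : Complex.I • xSum P ∈ g) (hS : Complex.I • zzSum S ∈ g) :
    Complex.I • zzSum (S \ cut P) ∈ g := by
  have h := g.sub_mem hS (zzSum_inter_cut_mem hP hS)
  rwa [← smul_sub, ← zzSum_add_zzSum_diff (Set.inter_subset_left (s := S) (t := cut P)),
    add_sub_cancel_left, Set.sdiff_self_inter] at h

/-! ### Separating vertices by the parity of their degrees -/

/-- The eigenvalue of `Z` at a computational basis state of a qubit. -/
def zSign (b : Fin 2) : ℤ := if b = 0 then 1 else -1

/-- The eigenvalue of `Z_u Z_v` at a computational basis state. -/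
def zzSign {U : Type*} (x : U → Fin 2) (e : Sym2 U) : ℤ :=
  Sym2.lift ⟨fun u v => zSign (x u) * zSign (x v), fun _ _ => mul_comm _ _⟩ e

theorem ZZ_eq_diagonal (e : Sym2 V) :
    (ZZ e : Operator V) = Matrix.diagonal fun x => (zzSign x e : ℂ) := by
  have hz : ∀ b, pauliZ b b = (zSign b : ℂ) := by
    intro b
    fin_cases b <;> simp [pauliZ, zSign]
  induction e with | _ u v
  change Z u * Z v = _
  simp only [Z_eq_diagonal, Matrix.diagonal_mul_diagonal, zzSign, Sym2.lift_mk, hz, Int.cast_mul]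

theorem zzSign_sub_zzSign {U : Type*} {x y : U → Fin 2} {u : U} (h : ∀ v, v ≠ u → x v = y v)
    (hu : x u ≠ y u) {e : Sym2 U} (he : ¬e.IsDiag) :
    ∃ m : ℤ, zzSign x e - zzSign y e = 2 * m ∧ (Odd m ↔ u ∈ e) ∧ |m| ≤ 1 := by
  have key : ∀ v, u ≠ v →
      ∃ m : ℤ, zzSign x s(u, v) - zzSign y s(u, v) = 2 * m ∧ Odd m ∧ |m| ≤ 1 := by
    intro v hv
    simp only [zzSign, Sym2.lift_mk, ← h v hv.symm]
    revert hu
    generalize x u = a, y u = b, x v = d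
    revert a b d
    have h1 : ∀ a b d : Fin 2, a ≠ b →
        zSign a * zSign d - zSign b * zSign d = 2 * 1 ∨
        zSign a * zSign d - zSign b * zSign d = 2 * (-1) := by decide
    intro a b d hab
    rcases h1 a b d hab with h1 | h1
    · exact ⟨1, h1, by decide, by simp⟩
    · exact ⟨-1, h1, by decide, by simp⟩
  by_cases hue : u ∈ e
  · obtain ⟨v, rfl⟩ := hue
    obtain ⟨m, h1, h2, h3⟩ := key v (by simpa using he)
    exact ⟨m, h1, by simpa using h2, h3⟩
  · refine ⟨0, ?_, by simpa using hue, by simp⟩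
    induction e with | _ a b
    simp only [Sym2.mem_iff, not_or] at hue
    simp [zzSign, h a (Ne.symm hue.1), h b (Ne.symm hue.2)]

/-- The eigenvalue of `zzSum S` at a computational basis state. -/
noncomputable def energy (S : Set (Sym2 V)) (x : V → Fin 2) : ℤ :=
  ∑ e, S.indicator (zzSign x) e

theorem zzSum_eq_diagonal (S : Set (Sym2 V)) :
    zzSum S = Matrix.diagonal fun x => (energy S x : ℂ) := by
  ext x y
  rw [zzSum, Matrix.sum_apply, Matrix.diagonal_apply]
  split_ifs with hxy
  · subst hxy
    rw [energy, Int.cast_sum]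
    refine Finset.sum_congr rfl fun e _ => ?_
    by_cases he : e ∈ S <;> simp [he, ZZ_eq_diagonal]
  · refine Finset.sum_eq_zero fun e _ => ?_
    by_cases he : e ∈ S <;> simp [he, ZZ_eq_diagonal, hxy]

/-- Flipping `u` negates exactly the terms of the edges at `u`, each changing by `±2`. So `m` is a
sum of as many signs `±1` as there are such edges, and its parity does not depend on the state. The
crude bound on `|m|` makes the set of possible values finite, as interpolation requires. -/
theorem energy_sub_energy {S : Set (Sym2 V)} (hS : ∀ e ∈ S, ¬e.IsDiag) {x y : V → Fin 2} {u : V}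
    (h : ∀ v, v ≠ u → x v = y v) (hu : x u ≠ y u) :
    ∃ m : ℤ, energy S x - energy S y = 2 * m ∧ (Odd m ↔ Odd {e ∈ S | u ∈ e}.ncard) ∧
      |m| ≤ Fintype.card (Sym2 V) := by
  classical
  have hm : ∀ e, ∃ m : ℤ, S.indicator (zzSign x) e - S.indicator (zzSign y) e = 2 * m ∧
      (Odd m ↔ e ∈ S ∧ u ∈ e) ∧ |m| ≤ 1 := by
    intro e
    by_cases he : e ∈ S
    · simpa [he] using zzSign_sub_zzSign h hu (hS e he)
    · exact ⟨0, by simp [he]⟩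
  choose m h1 h2 h3 using hm
  refine ⟨∑ e, m e, ?_, ?_, ?_⟩
  · simp only [energy, ← Finset.sum_sub_distrib, h1, Finset.mul_sum]
  · have : ((∑ e, m e : ℤ) : ZMod 2) = ({e ∈ S | u ∈ e}.ncard : ℕ) := by
      rw [Set.ncard_eq_toFinset_card', Finset.card_eq_sum_ones, Int.cast_sum, Nat.cast_sum,
        Set.toFinset_ofPred, Finset.sum_filter]
      refine Finset.sum_congr rfl fun e _ => ?_
      by_cases he : e ∈ S ∧ u ∈ e
      · rw [if_pos he]
        have := (ZMod.intCast_eq_one_iff_odd).2 ((h2 e).2 he)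
        simpa using this
      · rw [if_neg he]
        have := (h2 e).not.2 he
        rw [Int.not_odd_iff_even] at this
        exact (ZMod.intCast_eq_zero_iff_even).2 this
    rw [← ZMod.natCast_eq_one_iff_odd, ← ZMod.intCast_eq_one_iff_odd, this]
  · refine (Finset.abs_sum_le_sum_abs _ _).trans ((Finset.sum_le_sum fun e _ => h3 e).trans ?_)
    simp

theorem X_apply_eq_zero {x y : V → Fin 2} {u : V} (h : ¬((∀ v, v ≠ u → x v = y v) ∧ x u ≠ y u)) :
    X u x y = 0 := by
  simp only [X, onQubit, Matrix.of_apply]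
  rw [not_and_or] at h
  rcases h with h | h
  · push Not at h
    obtain ⟨v, hv, hxy⟩ := h
    refine Finset.prod_eq_zero (Finset.mem_univ v) ?_
    rw [if_neg hv, Matrix.one_apply_ne hxy]
  · refine Finset.prod_eq_zero (Finset.mem_univ u) ?_
    rw [not_not] at h
    rw [if_pos rfl, h]
    generalize y u = b
    fin_cases b <;> simp [pauliX]

theorem exists_polynomial_odd (N : ℕ) :
    ∃ q : Polynomial ℝ, ∀ m : ℤ, |m| ≤ N →
      (Odd m → q.eval (-(2 * m : ℝ) ^ 2) = 1) ∧ (¬Odd m → q.eval (-(2 * m : ℝ) ^ 2) = 0) := by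
  classical
  let v : ℕ → ℝ := fun k => -(2 * k : ℝ) ^ 2
  have hv : Set.InjOn v (Finset.range (N + 1)) := by
    intro a _ b _ hab
    simp only [v, neg_inj, mul_pow] at hab
    have : (a : ℝ) ^ 2 = (b : ℝ) ^ 2 := by linarith
    exact_mod_cast (pow_left_inj₀ (Nat.cast_nonneg a) (Nat.cast_nonneg b) two_ne_zero).mp this
  refine ⟨Lagrange.interpolate (Finset.range (N + 1)) v fun k => if Odd k then 1 else 0, ?_⟩
  intro m hm
  have hN : m.natAbs ∈ Finset.range (N + 1) := by
    rw [Finset.mem_range]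
    rw [Int.abs_eq_natAbs] at hm
    omega
  have he : -(2 * m : ℝ) ^ 2 = v m.natAbs := by
    simp only [v, mul_pow]
    rw [Nat.cast_natAbs, Int.cast_abs, sq_abs]
  rw [he, Lagrange.eval_interpolate_at_node _ hv hN]
  simp only [Int.natAbs_odd]
  constructor <;> intro h <;> simp [h]

/-- Splitting off the vertices of odd degree with respect to a set of edges. -/
theorem xSum_odd_mem {g : LieSubalgebra ℝ (Operator V)} {P : Set V} {S : Set (Sym2 V)}
    (hd : ∀ e ∈ S, ¬e.IsDiag) (hP : Complex.I • xSum P ∈ g) (hS : Complex.I • zzSum S ∈ g) :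
    Complex.I • xSum {u ∈ P | Odd {e ∈ S | u ∈ e}.ncard} ∈ g := by
  classical
  obtain ⟨q, hq⟩ := exists_polynomial_odd (Fintype.card (Sym2 V))
  -- The bracket with `i` times a diagonal matrix multiplies the entry at `(x, y)` by `i` times the
  -- energy difference. Its square multiplies by a real number, so real polynomials in the square
  -- preserve the real Lie algebra `g`.
  have key : ∀ (p : Polynomial ℝ) (A : Operator V), A ∈ g →
      (Matrix.of fun x y => ((p.eval (-((energy S x - energy S y : ℤ) : ℝ) ^ 2) : ℝ) : ℂ) * A x y) ∈
        g := by
    intro p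
    induction p using Polynomial.induction_on' with
    | add p p' hp hp' =>
      intro A hA
      convert g.add_mem (hp A hA) (hp' A hA) using 1
      ext x y
      simp [add_mul]
    | monomial n a =>
      induction n with
      | zero =>
        intro A hA
        convert g.smul_mem a hA using 1
        ext x y
        simp
      | succ n ih =>
        intro A hA
        convert ih _ (g.lie_mem hS (g.lie_mem hS hA)) using 1
        ext x y
        simp only [zzSum_eq_diagonal, Ring.lie_def, Matrix.of_apply, Matrix.sub_apply, mul_sub,
          sub_mul, smul_mul_assoc, mul_smul_comm, Matrix.smul_apply, Matrix.diagonal_mul,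
          Matrix.mul_diagonal, smul_eq_mul, Polynomial.eval_monomial]
        push_cast
        have hI := Complex.I_sq
        grind
  convert key q _ hP using 1
  ext x y
  simp only [xSum, Matrix.of_apply, Matrix.smul_apply, Matrix.sum_apply, smul_eq_mul,
    Finset.mul_sum]
  refine Finset.sum_congr rfl fun u _ => ?_
  by_cases hu : u ∈ P
  · by_cases hxy : (∀ v, v ≠ u → x v = y v) ∧ x u ≠ y u
    · obtain ⟨m, h1, h2, h3⟩ := energy_sub_energy hd hxy.1 hxy.2
      have hqm := hq m h3
      rw [h1]
      push_cast
      by_cases ho : Odd {e ∈ S | u ∈ e}.ncard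
      · have := hqm.1 (h2.2 ho)
        simp only [this, Complex.ofReal_one, one_mul]
        rw [Set.indicator_of_mem (show u ∈ {u ∈ P | Odd {e ∈ S | u ∈ e}.ncard} from ⟨hu, ho⟩),
          Set.indicator_of_mem hu]
      · have := hqm.2 (h2.not.2 ho)
        simp only [this, Complex.ofReal_zero, zero_mul]
        rw [Set.indicator_of_notMem
          (show u ∉ {u ∈ P | Odd {e ∈ S | u ∈ e}.ncard} from fun h => ho h.2)]
        simp
    · have h0 := X_apply_eq_zero hxy
      rw [Set.indicator_of_mem hu, h0]
      by_cases ho : u ∈ {u ∈ P | Odd {e ∈ S | u ∈ e}.ncard}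
      · rw [Set.indicator_of_mem ho, h0]
        simp
      · rw [Set.indicator_of_notMem ho]
        simp
  · rw [Set.indicator_of_notMem hu, Set.indicator_of_notMem fun h => hu h.1]
    simp

end

/-! ### Parity-equitable relations and a criterion for freeness -/

/-- An equivalence relation on the vertices is parity-equitable if equivalent vertices have, up to
parity, the same number of neighbours in each class. -/
def IsParityEquitable {V : Type*} (G : SimpleGraph V) (r : Setoid V) : Prop :=
  ∀ u v w, r u v → (Odd {x | G.Adj u x ∧ r x w}.ncard ↔ Odd {x | G.Adj v x ∧ r x w}.ncard)

/-- A graph is parity-rigid if equality is its only parity-equitable equivalence relation. -/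
def IsParityRigid {V : Type*} (G : SimpleGraph V) : Prop :=
  ∀ r, IsParityEquitable G r → ∀ u v, r u v → u = v

theorem ncard_edges_eq_ncard_neighbors {V : Type*} {S : Set (Sym2 V)} {T : Set V} {u : V}
    (hS : ∀ x, s(u, x) ∈ S ↔ x ∈ T) :
    {e ∈ S | u ∈ e}.ncard = T.ncard := by
  rw [← Set.ncard_image_of_injective T fun x y h => Sym2.congr_right.mp h]
  congr 1
  ext e
  constructor
  · rintro ⟨he, x, rfl⟩
    exact ⟨x, (hS x).1 he, rfl⟩
  · rintro ⟨x, hx, rfl⟩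
    exact ⟨(hS x).2 hx, Sym2.mem_mk_left u x⟩

section

attribute [local instance 100] LieRing.ofAssociativeRing

variable {V : Type*} [Fintype V] [DecidableEq V]

theorem problemHamiltonian_eq_zzSum (G : SimpleGraph V) :
    problemHamiltonian G = zzSum G.edgeSet := by
  classical
  rw [problemHamiltonian, zzSum, ← Finset.sum_indicator_subset _ (Finset.subset_univ _)]
  refine Finset.sum_congr rfl fun e _ => ?_
  by_cases he : e ∈ G.edgeSet <;> simp [he]

theorem mixerHamiltonian_eq_xSum : mixerHamiltonian V = xSum Set.univ := by
  simp [mixerHamiltonian, xSum]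

theorem zzSum_diff_cuts_mem {g : LieSubalgebra ℝ (Operator V)} {r : Setoid V}
    {S : Set (Sym2 V)} (hS : Complex.I • zzSum S ∈ g)
    (hr : ∀ a, Complex.I • xSum {v | r v a} ∈ g) (T : Finset V) :
    Complex.I • zzSum {e ∈ S | ∀ c ∈ T, e ∉ cut {v | r v c}} ∈ g := by
  induction T using Finset.induction_on with
  | empty => simpa using hS
  | insert a T _ ih =>
    convert zzSum_diff_cut_mem (hr a) ih using 3
    ext e
    simp only [Finset.mem_insert, forall_eq_or_imp, Set.mem_ofPred_eq, Set.mem_sdiff]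
    tauto

/-- Both splittings combine. For different classes, the cuts of the two classes meet in precisely
the edges between them; for equal classes, removing the cuts of all classes leaves only edges inside
classes. The degree of a vertex of the class of `a` in the remaining edges is its number of
neighbours in the class of `b`. -/
theorem xSum_refine_mem {G : SimpleGraph V} {g : LieSubalgebra ℝ (Operator V)} {r : Setoid V}
    (hG : Complex.I • zzSum G.edgeSet ∈ g) (hr : ∀ a, Complex.I • xSum {v | r v a} ∈ g)
    (a b : V) :
    Complex.I • xSum {u | r u a ∧ Odd {x | G.Adj u x ∧ r x b}.ncard} ∈ g := by
  by_cases hab : r a b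
  · have hS := zzSum_diff_cuts_mem hG hr Finset.univ
    have := xSum_odd_mem (fun e he => G.not_isDiag_of_mem_edgeSet he.1) (hr a) hS
    convert this using 3
    ext u
    refine and_congr_right fun hu => ?_
    rw [ncard_edges_eq_ncard_neighbors]
    intro x
    simp only [Finset.mem_univ, forall_const, Set.mem_ofPred_eq, SimpleGraph.mem_edgeSet,
      mk_mem_cut, not_not]
    refine and_congr_right fun _ => ?_
    have hu' : r u a := hu
    constructor
    · intro h
      exact r.trans ((h u).1 (r.refl u)) (r.trans hu hab)
    · intro h c
      have hux : r u x := r.trans hu (r.trans hab (r.symm h))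
      exact ⟨fun h => r.trans (r.symm hux) h, fun h => r.trans hux h⟩
  · have hS := zzSum_inter_cut_mem (hr b) (zzSum_inter_cut_mem (hr a) hG)
    have := xSum_odd_mem (fun e he => G.not_isDiag_of_mem_edgeSet he.1.1) (hr a) hS
    convert this using 3
    ext u
    refine and_congr_right fun hu => ?_
    rw [ncard_edges_eq_ncard_neighbors]
    intro x
    have hu' : r u a := hu
    have hub : ¬r u b := fun h => hab (r.trans (r.symm hu) h)
    simp only [Set.mem_inter_iff, SimpleGraph.mem_edgeSet, mk_mem_cut, Set.mem_ofPred_eq, hu', hub,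
      true_iff, false_iff, not_not, and_assoc]
    refine and_congr_right fun _ => ⟨fun h => h.2, fun h => ⟨fun hx => ?_, h⟩⟩
    exact hab (r.trans (r.symm hx) h)

/-- Among the finitely many relations whose class sums lie in `g`, a minimal one works: if it
violated the parity condition for the class of `b`, dividing classes by that parity would give a
strictly finer relation of the same kind. -/
theorem exists_parityEquitable_xSum_mem {G : SimpleGraph V} {g : LieSubalgebra ℝ (Operator V)}
    (hG : Complex.I • zzSum G.edgeSet ∈ g) (hV : Complex.I • xSum Set.univ ∈ g) :
    ∃ r, IsParityEquitable G r ∧ ∀ a, Complex.I • xSum {v | r v a} ∈ g := by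
  classical
  have hne : {r : Setoid V | ∀ a, Complex.I • xSum {v | r v a} ∈ g}.Nonempty := by
    refine ⟨⊤, fun a => ?_⟩
    convert hV using 3
    exact Set.eq_univ_of_forall fun v => trivial
  have : Finite (Setoid V) :=
    Finite.of_injective (fun r : Setoid V => fun u v => r u v) fun r s h =>
      Setoid.ext fun u v => iff_of_eq (congrFun (congrFun h u) v)
  obtain ⟨r, hr, hmin⟩ := (Set.toFinite _).exists_minimal hne
  refine ⟨r, fun u v b huv => ?_, hr⟩
  let r' : Setoid V := r ⊓ Setoid.ker (fun u => Odd {x | G.Adj u x ∧ r x b}.ncard)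
  have hr'_iff : ∀ u v, r' u v ↔ r u v ∧
      (Odd {x | G.Adj u x ∧ r x b}.ncard ↔ Odd {x | G.Adj v x ∧ r x b}.ncard) := by
    intro u v
    exact Setoid.inf_iff_and.trans (and_congr_right fun _ => Setoid.ker_def.trans eq_iff_iff)
  have hr' : ∀ a, Complex.I • xSum {v | r' v a} ∈ g := by
    intro a
    have h1 := xSum_refine_mem hG hr a b
    by_cases ha : Odd {x | G.Adj a x ∧ r x b}.ncard
    · convert h1 using 3
      ext u
      simp only [Set.mem_ofPred_eq, hr'_iff, ha, iff_true]
    · have h2 := g.sub_mem (hr a) h1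
      rw [← smul_sub, ← xSum_add_xSum_diff (P := {v | r v a})
        (Q := {u | r u a ∧ Odd {x | G.Adj u x ∧ r x b}.ncard}) fun u hu => hu.1,
        add_sub_cancel_left] at h2
      convert h2 using 3
      ext u
      simp only [Set.mem_ofPred_eq, hr'_iff, ha, iff_false, Set.mem_sdiff]
      tauto
  exact ((hr'_iff u v).1 (hmin hr' inf_le_left huv)).2

theorem dla_le_multiAngleDLA (G : SimpleGraph V) : dla G ≤ multiAngleDLA G := by
  classical
  rw [dla, LieSubalgebra.lieSpan_le]
  rintro A (rfl | rfl)
  · rw [problemHamiltonian, Finset.smul_sum]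
    refine sum_mem fun e he => ?_
    induction e with | _ u v
    exact LieSubalgebra.subset_lieSpan (Or.inr ⟨u, v, by simpa using he, rfl⟩)
  · rw [mixerHamiltonian, Finset.smul_sum]
    exact sum_mem fun u _ => LieSubalgebra.subset_lieSpan (Or.inl ⟨u, rfl⟩)

theorem IsParityRigid.isFree {G : SimpleGraph V} (h : IsParityRigid G) : IsFree G := by
  refine le_antisymm (dla_le_multiAngleDLA G) ?_
  have hG : Complex.I • zzSum G.edgeSet ∈ dla G := by
    rw [← problemHamiltonian_eq_zzSum]
    exact LieSubalgebra.subset_lieSpan (Or.inl rfl)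
  have hV : Complex.I • xSum Set.univ ∈ dla G := by
    rw [← mixerHamiltonian_eq_xSum]
    exact LieSubalgebra.subset_lieSpan (Or.inr rfl)
  obtain ⟨r, hr, hmem⟩ := exists_parityEquitable_xSum_mem hG hV
  have hX : ∀ u, Complex.I • xSum {u} ∈ dla G := by
    intro u
    convert hmem u using 3
    ext v
    exact ⟨fun hv => by rw [Set.mem_singleton_iff.mp hv]; exact r.refl u, fun hv => h r hr v u hv⟩
  rw [multiAngleDLA, LieSubalgebra.lieSpan_le]
  rintro A (⟨u, rfl⟩ | ⟨u, v, huv, rfl⟩)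
  · have hu := hX u
    rwa [xSum_singleton] at hu
  · have hS := zzSum_inter_cut_mem (hX v) (zzSum_inter_cut_mem (hX u) hG)
    -- An edge with exactly one end in `{u}` and exactly one end in `{v}` must join `u` to `v`.
    have hset : G.edgeSet ∩ cut {u} ∩ cut {v} = {s(u, v)} := by
      ext e
      induction e with | _ a b
      simp only [Set.mem_inter_iff, SimpleGraph.mem_edgeSet, mk_mem_cut, Set.mem_singleton_iff,
        Sym2.eq_iff]
      constructor
      · have := huv.ne
        rintro ⟨⟨_, _⟩, _⟩
        grind
      · rintro (⟨rfl, rfl⟩ | ⟨rfl, rfl⟩)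
        · simp [huv, huv.ne, huv.ne']
        · simp [huv.symm, huv.ne, huv.ne']
    rw [hset, zzSum_singleton] at hS
    exact hS

end

/-! ### Saturated sets and their closure properties -/

/-- A set is saturated if it is a union of equivalence classes. -/
def IsSaturated {V : Type*} (r : Setoid V) (s : Set V) : Prop :=
  ∀ u v, r u v → u ∈ s → v ∈ s

namespace IsSaturated

variable {V : Type*} {r : Setoid V} {s t : Set V}

theorem mem_iff (hs : IsSaturated r s) {u v : V} (h : r u v) : u ∈ s ↔ v ∈ s :=
  ⟨hs u v h, hs v u (r.symm h)⟩

theorem univ : IsSaturated r Set.univ := fun _ _ _ _ => trivial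

theorem inter (hs : IsSaturated r s) (ht : IsSaturated r t) : IsSaturated r (s ∩ t) :=
  fun u v h hu => ⟨hs u v h hu.1, ht u v h hu.2⟩

theorem diff (hs : IsSaturated r s) (ht : IsSaturated r t) : IsSaturated r (s \ t) :=
  fun u v h hu => ⟨hs u v h hu.1, fun hv => hu.2 ((ht.mem_iff h).2 hv)⟩

theorem iInter {ι : Type*} {f : ι → Set V} (hf : ∀ i, IsSaturated r (f i)) :
    IsSaturated r (⋂ i, f i) :=
  fun u v h hu => Set.mem_iInter.2 fun i => hf i u v h (Set.mem_iInter.1 hu i)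

theorem eq_of_singleton {u v : V} (hs : IsSaturated r {u}) (h : r u v) : u = v :=
  (hs u v h rfl).symm

end IsSaturated

/-- The vertices with an odd number of neighbours in `s`. -/
def oddNeighbors {V : Type*} (G : SimpleGraph V) (s : Set V) : Set V :=
  {u | Odd {x | G.Adj u x ∧ x ∈ s}.ncard}

open Classical in
/-- The indicator of a proposition. -/
noncomputable def ind (p : Prop) : ℕ := if p then 1 else 0

theorem ind_of_not {p : Prop} (h : ¬p) : ind p = 0 := if_neg h

theorem ind_congr {p q : Prop} (h : p ↔ q) : ind p = ind q := by rw [propext h]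

theorem ncard_eq_sum {V : Type*} [Fintype V] (P : V → Prop) :
    {x | P x}.ncard = ∑ x, ind (P x) := by
  classical
  rw [Set.ncard_eq_toFinset_card', Finset.card_eq_sum_ones, Set.toFinset_ofPred,
    Finset.sum_filter]
  exact Finset.sum_congr rfl fun x _ => by by_cases h : P x <;> simp [h, ind]

theorem mem_oddNeighbors {V : Type*} [Fintype V] {G : SimpleGraph V} {s : Set V} {u : V} :
    u ∈ oddNeighbors G s ↔ (∑ x, ind (G.Adj u x ∧ x ∈ s)) % 2 = 1 := by
  rw [oddNeighbors, Set.mem_ofPred_eq, Nat.odd_iff, ncard_eq_sum]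

/-- The neighbours in `s` are counted class by class: mod 2, every summand is the same for
equivalent vertices. -/
theorem IsSaturated.oddNeighbors {V : Type*} [Finite V] {G : SimpleGraph V} {r : Setoid V}
    {s : Set V} (hr : IsParityEquitable G r) (hs : IsSaturated r s) :
    IsSaturated r (oddNeighbors G s) := by
  classical
  have := Fintype.ofFinite V
  have key : ∀ u, (({x | G.Adj u x ∧ x ∈ s}.ncard : ℕ) : ZMod 2) =
      ∑ q : Quotient r, if q.out ∈ s then ({x | G.Adj u x ∧ r x q.out}.ncard : ZMod 2) else 0 := by
    intro u
    simp only [ncard_eq_sum, Nat.cast_sum]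
    rw [← Finset.sum_fiberwise (g := fun x => (Quotient.mk r x))]
    refine Finset.sum_congr rfl fun q _ => ?_
    have hq : ∀ x, Quotient.mk r x = q ↔ r x q.out := by
      intro x
      conv_lhs => rw [← Quotient.out_eq q]
      exact Quotient.eq
    rw [Finset.sum_filter]
    split_ifs with h
    · refine Finset.sum_congr rfl fun x _ => ?_
      by_cases hx : r x q.out
      · simp [(hq x).2 hx, hx, (hs.mem_iff hx).2 h]
      · simp [(hq x).not.2 hx, hx, ind]
    · refine Finset.sum_eq_zero fun x _ => ?_
      by_cases hx : r x q.out
      · simp [(hs.mem_iff hx).not.2 h, ind]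
      · simp [(hq x).not.2 hx]
  intro u v huv hu
  simp only [QAOA.oddNeighbors, Set.mem_ofPred_eq, ← ZMod.natCast_eq_one_iff_odd] at hu ⊢
  rw [← hu, key, key]
  refine Finset.sum_congr rfl fun q _ => ?_
  split_ifs
  · have h2 : ∀ a b : ZMod 2, (a = 1 ↔ b = 1) → a = b := by decide
    apply h2
    simp only [ZMod.natCast_eq_one_iff_odd]
    exact (hr u v q.out huv).symm
  · rfl

theorem isParityRigid_of_singleton {V : Type*} {G : SimpleGraph V}
    (h : ∀ r, IsParityEquitable G r → ∀ u, IsSaturated r {u}) : IsParityRigid G :=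
  fun r hr u _ huv => (h r hr u).eq_of_singleton huv

theorem sum_ind_val_eq {m : ℕ} (P : ℕ → Prop) (k : ℕ) :
    ∑ b : Fin m, ind ((b : ℕ) = k ∧ P b) = ind (k < m ∧ P k) := by
  by_cases hk : k < m
  · rw [Finset.sum_eq_single ⟨k, hk⟩]
    · exact ind_congr (by simp [hk])
    · intro b _ hb
      exact ind_of_not fun h => hb (Fin.ext h.1)
    · simp
  · rw [ind_of_not fun h => hk h.1]
    refine Finset.sum_eq_zero fun b _ => ind_of_not fun h => ?_
    omega

/-- Counts the neighbours in `P` along a path, with the boundary conditions explicit. Predicates on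
`ℕ` avoid `Fin` arithmetic, so that later membership checks are left to `grind`. -/
theorem sum_ind_path {m : ℕ} (P : ℕ → Prop) {a : ℕ} (ha : a < m) :
    ∑ b : Fin m, ind ((a + 1 = b ∨ (b : ℕ) + 1 = a) ∧ P b) =
      ind (1 ≤ a ∧ P (a - 1)) + ind (a + 1 < m ∧ P (a + 1)) := by
  have h1 := sum_ind_val_eq (m := m) (fun b => 1 ≤ a ∧ P b) (a - 1)
  rw [← sum_ind_val_eq P (a + 1), ind_congr (q := a - 1 < m ∧ 1 ≤ a ∧ P (a - 1)) ⟨fun h =>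
    ⟨by omega, h⟩, fun h => h.2⟩, ← h1, ← Finset.sum_add_distrib]
  refine Finset.sum_congr rfl fun b _ => ?_
  by_cases hP : P b
  · simp only [hP, and_true, ind]
    split_ifs <;> omega
  · simp [hP, ind]

/-! ### Extended ladder graphs -/

section Ladder

variable {n k : ℕ} {r : Setoid (Fin (n + k) ⊕ Fin n)}

/-- The vertices of a ladder graph with numbers in given sets. -/
def ladderSet (n k : ℕ) (P Q : ℕ → Prop) : Set (Fin (n + k) ⊕ Fin n) :=
  {x | Sum.elim (fun a : Fin (n + k) => P a) (fun i : Fin n => Q i) x}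

theorem inl_mem_ladderSet {P Q : ℕ → Prop} {a : Fin (n + k)} :
    Sum.inl a ∈ ladderSet n k P Q ↔ P a := Iff.rfl

theorem inr_mem_ladderSet {P Q : ℕ → Prop} {i : Fin n} :
    Sum.inr i ∈ ladderSet n k P Q ↔ Q i := Iff.rfl

theorem ladderSet_oddNeighbors (P Q : ℕ → Prop) :
    oddNeighbors (extendedLadder n k) (ladderSet n k P Q) = ladderSet n k
      (fun a => (ind (1 ≤ a ∧ P (a - 1)) + ind (a + 1 < n + k ∧ P (a + 1)) +
        ind (k ≤ a ∧ Q (a - k))) % 2 = 1)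
      (fun i => (ind (P (i + k)) + (ind (1 ≤ i ∧ Q (i - 1)) +
        ind (i + 1 < n ∧ Q (i + 1)))) % 2 = 1) := by
  ext (a | i)
  · rw [mem_oddNeighbors, Fintype.sum_sum_type, inl_mem_ladderSet, ← sum_ind_path P a.2,
      ind_congr (p := k ≤ (a : ℕ) ∧ Q (a - k)) (q := (a : ℕ) - k < n ∧ k ≤ a ∧ Q (a - k))
        ⟨fun h => ⟨by omega, h⟩, fun h => h.2⟩,
      ← sum_ind_val_eq (m := n) (fun i => k ≤ a ∧ Q i) (a - k)]
    refine iff_of_eq (congrArg (fun m => m % 2 = 1) (congrArg₂ _ ?_ ?_)) <;>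
      refine Finset.sum_congr rfl fun b _ => ind_congr ?_
    · simp only [extendedLadder, SimpleGraph.fromRel_adj, inl_mem_ladderSet, ne_eq,
        Sum.inl.injEq, Fin.ext_iff]
      refine and_congr_left fun _ => ?_
      omega
    · simp only [extendedLadder, SimpleGraph.fromRel_adj, inr_mem_ladderSet, ne_eq,
        reduceCtorEq, not_false_eq_true, true_and, or_false, ← and_assoc]
      refine and_congr_left fun _ => ?_
      omega
  · rw [mem_oddNeighbors, Fintype.sum_sum_type, inr_mem_ladderSet, ← sum_ind_path Q i.2,
      ind_congr (p := P (i + k)) (q := (i : ℕ) + k < n + k ∧ P (i + k))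
        ⟨fun h => ⟨by omega, h⟩, fun h => h.2⟩,
      ← sum_ind_val_eq (m := n + k) P (i + k)]
    refine iff_of_eq (congrArg (fun m => m % 2 = 1) (congrArg₂ _ ?_ ?_)) <;>
      refine Finset.sum_congr rfl fun b _ => ind_congr ?_
    · simp only [extendedLadder, SimpleGraph.fromRel_adj, inl_mem_ladderSet, ne_eq,
        reduceCtorEq, not_false_eq_true, true_and, false_or]
    · simp only [extendedLadder, SimpleGraph.fromRel_adj, inr_mem_ladderSet, ne_eq,
        Sum.inr.injEq, Fin.ext_iff]
      refine and_congr_left fun _ => ?_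
      omega

theorem IsSaturated.ladderSet {s : Set (Fin (n + k) ⊕ Fin n)} (h : IsSaturated r s)
    {P Q : ℕ → Prop} (hP : ∀ a : Fin (n + k), P a ↔ Sum.inl a ∈ s) (hQ : ∀ i : Fin n, Q i ↔ Sum.inr i ∈ s) :
    IsSaturated r (ladderSet n k P Q) := by
  convert h using 1
  ext (a | i)
  · exact hP a
  · exact hQ i

/-- These are the vertices of even degree: `u_{n-1}`, `v_0`, `v_{n-1}`, and for `k = 2` also
`u_{-1}`. -/
theorem isSaturated_ladder_end (hr : IsParityEquitable (extendedLadder n k) r) (hn : 3 ≤ n)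
    (hk : k = 1 ∨ k = 2) :
    IsSaturated r (ladderSet n k (fun a => a ≠ 0 ∧ (a < k ∨ a + 1 = n + k))
      fun i => i = 0 ∨ i + 1 = n) := by
  have h0 : IsSaturated r (ladderSet n k (fun _ => True) fun _ => True) :=
    IsSaturated.univ.ladderSet (by simp) (by simp)
  refine (IsSaturated.univ.diff (h0.oddNeighbors hr)).ladderSet (fun a => ?_) fun i => ?_ <;>
    simp only [Set.mem_sdiff, Set.mem_univ, true_and, ladderSet_oddNeighbors,
      inl_mem_ladderSet, inr_mem_ladderSet, ind, and_true]
  · have := a.2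
    grind
  · have := i.2
    grind

/-- Rungs are numbered from the right. Among the even-degree vertices only the two of the last rung
are adjacent to each other, which isolates that rung; the others follow by passing from a rung to
its neighbouring rungs and removing what is known. -/
theorem isSaturated_ladder_column (hr : IsParityEquitable (extendedLadder n k) r) (hn : 3 ≤ n)
    (hk : k = 1 ∨ k = 2) (m : ℕ) (hm : m < n) :
    IsSaturated r (ladderSet n k (fun a => a + 1 + m = n + k) fun i => i + 1 + m = n) := by
  induction m using Nat.strong_induction_on with | _ m ih
  match m with
  | 0 =>
    have h := isSaturated_ladder_end hr hn hk
    refine (h.inter (h.oddNeighbors hr)).ladderSet (fun a => ?_) fun i => ?_ <;>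
      simp only [Set.mem_inter_iff, ladderSet_oddNeighbors, inl_mem_ladderSet,
        inr_mem_ladderSet, ind]
    · have := a.2
      grind
    · have := i.2
      grind
  | 1 =>
    have h := ih 0 one_pos (by omega)
    refine ((h.oddNeighbors hr).diff h).ladderSet (fun a => ?_) fun i => ?_ <;>
      simp only [Set.mem_sdiff, ladderSet_oddNeighbors, inl_mem_ladderSet,
        inr_mem_ladderSet, ind]
    · have := a.2
      grind
    · have := i.2
      grind
  | m + 2 =>
    have h := ih (m + 1) (by omega) (by omega)
    have h' := ih m (by omega) (by omega)
    refine (((h.oddNeighbors hr).diff h).diff h').ladderSet (fun a => ?_) fun i => ?_ <;>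
      simp only [Set.mem_sdiff, ladderSet_oddNeighbors, inl_mem_ladderSet,
        inr_mem_ladderSet, ind]
    · have := a.2
      grind
    · have := i.2
      grind

/-- The first rung is `{u_0, v_0}`, and only `v_0` has even degree, since `u_0` carries the attached
path. This separates the two sides, and the separation propagates from rung to rung. -/
theorem isSaturated_ladder_inr (hr : IsParityEquitable (extendedLadder n k) r) (hn : 3 ≤ n)
    (hk : k = 1 ∨ k = 2) (m : ℕ) (hm : m < n) :
    IsSaturated r (ladderSet n k (fun _ => False) fun i => i = m) := by
  induction m with
  | zero =>
    refine ((isSaturated_ladder_end hr hn hk).inter (isSaturated_ladder_column hr hn hk (n - 1)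
      (by omega))).ladderSet (fun a => ?_) fun i => ?_ <;>
      simp only [Set.mem_inter_iff, inl_mem_ladderSet, inr_mem_ladderSet]
    · grind
    · grind
  | succ m ih =>
    refine (((ih (by omega)).oddNeighbors hr).inter (isSaturated_ladder_column hr hn hk
      (n - 1 - (m + 1)) (by omega))).ladderSet (fun a => ?_) fun i => ?_ <;>
      simp only [Set.mem_inter_iff, ladderSet_oddNeighbors, inl_mem_ladderSet,
        inr_mem_ladderSet, ind, and_false, if_false]
    · have := a.2
      grind
    · have := i.2
      grind

theorem isSaturated_ladder_inl (hr : IsParityEquitable (extendedLadder n k) r) (hn : 3 ≤ n)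
    (hk : k = 1 ∨ k = 2) (m : ℕ) (hm : m < n + k) :
    IsSaturated r (ladderSet n k (fun a => a = m) fun _ => False) := by
  have hcol : ∀ m < n, IsSaturated r (ladderSet n k (fun a => a = m + k) fun _ => False) := by
    intro m hm
    refine ((isSaturated_ladder_column hr hn hk (n - 1 - m) (by omega)).diff
      (isSaturated_ladder_inr hr hn hk m hm)).ladderSet (fun a => ?_) fun i => ?_ <;>
      simp only [Set.mem_sdiff, inl_mem_ladderSet, inr_mem_ladderSet]
    · grind
    · grind
  have hpath : ∀ m, m + 1 = k → IsSaturated r (ladderSet n k (fun a => a = m) fun _ => False) := by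
    intro m hm
    refine ((((hcol 0 (by omega)).oddNeighbors hr).diff (hcol 1 (by omega))).diff
      (isSaturated_ladder_inr hr hn hk 0 (by omega))).ladderSet (fun a => ?_) fun i => ?_ <;>
      simp only [Set.mem_sdiff, ladderSet_oddNeighbors, inl_mem_ladderSet,
        inr_mem_ladderSet, ind, and_false, if_false]
    · have := a.2
      grind
    · have := i.2
      grind
  by_cases h1 : k ≤ m
  · have := hcol (m - k) (by omega)
    rwa [Nat.sub_add_cancel h1] at this
  · by_cases h2 : m + 1 = k
    · exact hpath m h2
    · refine (((hpath 1 (by omega)).oddNeighbors hr).diff (hcol 0 (by omega))).ladderSet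
        (fun a => ?_) fun i => ?_ <;>
        simp only [Set.mem_sdiff, ladderSet_oddNeighbors, inl_mem_ladderSet,
          inr_mem_ladderSet, ind, and_false, if_false]
      · have := a.2
        grind
      · have := i.2
        grind

theorem isParityRigid_extendedLadder (hn : 3 ≤ n) (hk : k = 1 ∨ k = 2) :
    IsParityRigid (extendedLadder n k) := by
  refine isParityRigid_of_singleton fun r hr u => ?_
  rcases u with a | i
  · convert isSaturated_ladder_inl hr hn hk a a.2 using 1
    ext (b | j)
    · simp [inl_mem_ladderSet, Fin.ext_iff]
    · simp [inr_mem_ladderSet]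
  · convert isSaturated_ladder_inr hr hn hk i i.2 using 1
    ext (b | j)
    · simp [inl_mem_ladderSet]
    · simp [inr_mem_ladderSet, Fin.ext_iff]

end Ladder

/-! ### Grid+1 graphs -/

section Grid

variable {w h : ℕ} {r : Setoid (Option (Fin (w + 1) × Fin (h + 1)))}

/-- A set of vertices of a grid+1 graph, given by its coordinates; `t` says whether the additional
vertex belongs to it. -/
def gridSet (w h : ℕ) (t : Prop) (P : ℕ → ℕ → Prop) : Set (Option (Fin (w + 1) × Fin (h + 1))) :=
  {x | x.elim t fun p => P p.1 p.2}

theorem none_mem_gridSet {t : Prop} {P : ℕ → ℕ → Prop} : none ∈ gridSet w h t P ↔ t := Iff.rfl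

theorem some_mem_gridSet {t : Prop} {P : ℕ → ℕ → Prop} {i : Fin (w + 1)} {j : Fin (h + 1)} :
    some (i, j) ∈ gridSet w h t P ↔ P i j := Iff.rfl

theorem sum_ind_grid (P : ℕ → ℕ → Prop) (i : Fin (w + 1)) (j : Fin (h + 1)) :
    ∑ q : Fin (w + 1) × Fin (h + 1), ind ((gridPlusOne w h).Adj (some (i, j)) (some q) ∧
      P q.1 q.2) =
    (ind (1 ≤ (i : ℕ) ∧ P (i - 1) j) + ind ((i : ℕ) + 1 < w + 1 ∧ P (i + 1) j)) +
      (ind (1 ≤ (j : ℕ) ∧ P i (j - 1)) + ind ((j : ℕ) + 1 < h + 1 ∧ P i (j + 1))) := by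
  have h1 : ∑ q : Fin (w + 1) × Fin (h + 1),
      ind ((q.2 : ℕ) = j ∧ ((i : ℕ) + 1 = q.1 ∨ (q.1 : ℕ) + 1 = i) ∧ P q.1 q.2) =
      ind (1 ≤ (i : ℕ) ∧ P (i - 1) j) + ind ((i : ℕ) + 1 < w + 1 ∧ P (i + 1) j) := by
    rw [Fintype.sum_prod_type, ← sum_ind_path (fun a => P a j) i.2]
    refine Finset.sum_congr rfl fun a _ => ?_
    rw [sum_ind_val_eq (m := h + 1) (fun b => ((i : ℕ) + 1 = a ∨ (a : ℕ) + 1 = i) ∧ P a b) j]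
    exact ind_congr (and_iff_right j.2)
  have h2 : ∑ q : Fin (w + 1) × Fin (h + 1),
      ind ((q.1 : ℕ) = i ∧ ((j : ℕ) + 1 = q.2 ∨ (q.2 : ℕ) + 1 = j) ∧ P q.1 q.2) =
      ind (1 ≤ (j : ℕ) ∧ P i (j - 1)) + ind ((j : ℕ) + 1 < h + 1 ∧ P i (j + 1)) := by
    rw [Fintype.sum_prod_type_right, ← sum_ind_path (fun b => P i b) j.2]
    refine Finset.sum_congr rfl fun b _ => ?_
    rw [sum_ind_val_eq (m := w + 1) (fun a => ((j : ℕ) + 1 = b ∨ (b : ℕ) + 1 = j) ∧ P a b) i]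
    exact ind_congr (and_iff_right i.2)
  rw [← h1, ← h2, ← Finset.sum_add_distrib]
  refine Finset.sum_congr rfl fun q _ => ?_
  obtain ⟨a, b⟩ := q
  have hadj : (gridPlusOne w h).Adj (some (i, j)) (some (a, b)) ↔
      ((b : ℕ) = j ∧ ((i : ℕ) + 1 = a ∨ (a : ℕ) + 1 = i)) ∨
      ((a : ℕ) = i ∧ ((j : ℕ) + 1 = b ∨ (b : ℕ) + 1 = j)) := by
    simp only [gridPlusOne, SimpleGraph.fromRel_adj, ne_eq, Option.some.injEq, Prod.mk.injEq,
      Fin.ext_iff]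
    omega
  rw [ind_congr (and_congr_left fun _ => hadj)]
  by_cases hP : P a b
  · simp only [hP, and_true]
    grind [ind]
  · simp [hP, ind]

theorem gridSet_oddNeighbors (t : Prop) (P : ℕ → ℕ → Prop) :
    oddNeighbors (gridPlusOne w h) (gridSet w h t P) = gridSet w h (P 0 0) fun i j =>
      (ind (i = 0 ∧ j = 0 ∧ t) + ((ind (1 ≤ i ∧ P (i - 1) j) + ind (i + 1 < w + 1 ∧ P (i + 1) j)) +
        (ind (1 ≤ j ∧ P i (j - 1)) + ind (j + 1 < h + 1 ∧ P i (j + 1))))) % 2 = 1 := by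
  ext (_ | ⟨i, j⟩)
  · rw [mem_oddNeighbors, Fintype.sum_option, Finset.sum_eq_single (0, 0)]
    · have hadj : (gridPlusOne w h).Adj none (some (0, 0)) := by
        simp [gridPlusOne]
      simp only [SimpleGraph.irrefl, hadj, none_mem_gridSet, some_mem_gridSet, Fin.val_zero]
      grind [ind]
    · intro q _ hq
      exact ind_of_not fun h => by simp [gridPlusOne, hq] at h
    · simp
  · rw [mem_oddNeighbors, Fintype.sum_option, some_mem_gridSet, ← sum_ind_grid]
    refine iff_of_eq (congrArg (fun m => m % 2 = 1) (congrArg₂ _ (ind_congr ?_) rfl))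
    simp only [gridPlusOne, SimpleGraph.fromRel_adj, ne_eq, reduceCtorEq, not_false_eq_true,
      true_and, false_or, none_mem_gridSet, Prod.ext_iff, Fin.ext_iff, Fin.val_zero, and_assoc]

theorem IsSaturated.gridSet {s : Set (Option (Fin (w + 1) × Fin (h + 1)))} (hs : IsSaturated r s)
    {t : Prop} {P : ℕ → ℕ → Prop} (ht : t ↔ none ∈ s)
    (hP : ∀ (i : Fin (w + 1)) (j : Fin (h + 1)), P i j ↔ some (i, j) ∈ s) :
    IsSaturated r (gridSet w h t P) := by
  convert hs using 1
  ext (_ | ⟨i, j⟩)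
  · exact ht
  · exact hP i j

/-- These are the vertices of odd degree. The extra edge gives the corner `u_{0,0}` degree 3, while
the other three corners have degree 2. -/
theorem isSaturated_grid_border (hr : IsParityEquitable (gridPlusOne w h) r) (hh : 3 ≤ h)
    (hw : h < w) :
    IsSaturated r (gridSet w h True fun i j => (i = 0 ∨ i = w ∨ j = 0 ∨ j = h) ∧
      ¬(i = w ∧ j = 0) ∧ ¬(i = 0 ∧ j = h) ∧ ¬(i = w ∧ j = h)) := by
  have h0 : IsSaturated r (gridSet w h True fun _ _ => True) :=
    IsSaturated.univ.gridSet (by simp) (by simp)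
  refine (h0.oddNeighbors hr).gridSet ?_ fun i j => ?_ <;>
    simp only [gridSet_oddNeighbors, none_mem_gridSet, some_mem_gridSet, ind, and_true]
  have := i.2
  have := j.2
  grind

/-- Within the odd-degree vertices, those of odd degree again are the additional vertex, `u_{0,0}`,
and the six neighbours of the three missing corners. -/
theorem isSaturated_grid_corner (hr : IsParityEquitable (gridPlusOne w h) r) (hh : 3 ≤ h)
    (hw : h < w) :
    IsSaturated r (gridSet w h True fun i j => (i = 0 ∧ j = 0) ∨ (i + 1 = w ∧ j = 0) ∨
      (i = w ∧ j = 1) ∨ (i + 1 = w ∧ j = h) ∨ (i = w ∧ j + 1 = h) ∨ (i = 0 ∧ j + 1 = h) ∨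
      (i = 1 ∧ j = h)) := by
  have h0 := isSaturated_grid_border hr hh hw
  refine (h0.inter (h0.oddNeighbors hr)).gridSet ?_ fun i j => ?_ <;>
    simp only [gridSet_oddNeighbors, none_mem_gridSet, some_mem_gridSet, ind, Set.mem_inter_iff]
  · grind
  obtain ⟨i, hi⟩ := i
  obtain ⟨j, hj⟩ := j
  have hi' : i = 0 ∨ i = 1 ∨ (2 ≤ i ∧ i + 2 ≤ w) ∨ i + 1 = w ∨ i = w := by omega
  have hj' : j = 0 ∨ j = 1 ∨ (2 ≤ j ∧ j + 2 ≤ h) ∨ j + 1 = h ∨ j = h := by omega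
  rcases hi' with hi' | hi' | hi' | hi' | hi' <;>
    rcases hj' with hj' | hj' | hj' | hj' | hj' <;> grind (splits := 20)

/-- The previous step is repeated. The additional vertex and `u_{0,0}` are adjacent; the only other
possible adjacency is along the side `i = w`, between `j = 1` and `j = h - 1`, and it occurs exactly
when `h = 3`. -/
theorem isSaturated_grid_origin (hr : IsParityEquitable (gridPlusOne w h) r) (hh : 3 ≤ h)
    (hw : h < w) :
    IsSaturated r (gridSet w h True fun i j => (i = 0 ∧ j = 0) ∨
      (h = 3 ∧ i = w ∧ (j = 1 ∨ j = 2))) := by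
  have h0 := isSaturated_grid_corner hr hh hw
  refine (h0.inter (h0.oddNeighbors hr)).gridSet ?_ fun i j => ?_ <;>
    simp only [gridSet_oddNeighbors, none_mem_gridSet, some_mem_gridSet, ind, Set.mem_inter_iff]
  · grind
  obtain ⟨i, hi⟩ := i
  obtain ⟨j, hj⟩ := j
  have hi' : i = 0 ∨ i = 1 ∨ (2 ≤ i ∧ i + 2 ≤ w) ∨ i + 1 = w ∨ i = w := by omega
  have hj' : j = 0 ∨ j = 1 ∨ (2 ≤ j ∧ j + 2 ≤ h) ∨ j + 1 = h ∨ j = h := by omega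
  rcases hi' with hi' | hi' | hi' | hi' | hi' <;>
    rcases hj' with hj' | hj' | hj' | hj' | hj' <;> grind (splits := 20)

/-- A front moves from `u_{0,0}` along both adjacent sides at the same speed; it cannot yet tell the
two sides apart. -/
theorem isSaturated_grid_pair (hr : IsParityEquitable (gridPlusOne w h) r) (hh : 3 ≤ h)
    (hw : h < w) (d : ℕ) (hd : d + 2 ≤ h) :
    IsSaturated r (gridSet w h False fun i j => (i = d + 1 ∧ j = 0) ∨ (i = 0 ∧ j = d + 1)) := by
  have hB := isSaturated_grid_border hr hh hw
  induction d using Nat.strong_induction_on with | _ d ih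
  match d with
  | 0 =>
    have h0 := isSaturated_grid_origin hr hh hw
    refine (((h0.oddNeighbors hr).inter hB).diff h0).gridSet ?_ fun i j => ?_ <;>
      simp only [gridSet_oddNeighbors, none_mem_gridSet, some_mem_gridSet, ind,
        Set.mem_inter_iff, Set.mem_sdiff]
    · grind
    have := i.2
    have := j.2
    grind (splits := 20)
  | 1 =>
    have h0 := ih 0 one_pos (by omega)
    -- The common neighbours `u_{0,0}` and `u_{1,1}` of the pair are counted twice and cancel.
    refine (h0.oddNeighbors hr).gridSet ?_ fun i j => ?_ <;>
      simp only [gridSet_oddNeighbors, none_mem_gridSet, some_mem_gridSet, ind]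
    · grind
    have := i.2
    have := j.2
    grind (splits := 20)
  | d + 2 =>
    have h0 := ih (d + 1) (by omega) (by omega)
    have h1 := ih d (by omega) (by omega)
    refine (((h0.oddNeighbors hr).inter hB).diff h1).gridSet ?_ fun i j => ?_ <;>
      simp only [gridSet_oddNeighbors, none_mem_gridSet, some_mem_gridSet, ind,
        Set.mem_inter_iff, Set.mem_sdiff]
    · grind
    have := i.2
    have := j.2
    grind (splits := 20)

/-- Here `h < w` breaks the symmetry: the next front would contain `u_{h,0}` and `u_{0,h}`, but the
latter is a corner of even degree and drops out. From `u_{h,0}` one walks back, choosing in each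
pair the neighbour of the vertex already found. -/
theorem isSaturated_grid_row (hr : IsParityEquitable (gridPlusOne w h) r) (hh : 3 ≤ h)
    (hw : h < w) (m : ℕ) (hm : m + 1 ≤ h) :
    IsSaturated r (gridSet w h False fun i j => i + m = h ∧ j = 0) := by
  induction m with
  | zero =>
    have h0 := isSaturated_grid_pair hr hh hw (h - 2) (by omega)
    have h1 := isSaturated_grid_pair hr hh hw (h - 3) (by omega)
    refine (((h0.oddNeighbors hr).inter (isSaturated_grid_border hr hh hw)).diff h1).gridSet
      ?_ fun i j => ?_ <;>
      simp only [gridSet_oddNeighbors, none_mem_gridSet, some_mem_gridSet, ind,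
        Set.mem_inter_iff, Set.mem_sdiff]
    · grind
    have := i.2
    have := j.2
    grind (splits := 20)
  | succ m ih =>
    have h0 := isSaturated_grid_pair hr hh hw (h - (m + 2)) (by omega)
    refine (((ih (by omega)).oddNeighbors hr).inter h0).gridSet ?_ fun i j => ?_ <;>
      simp only [gridSet_oddNeighbors, none_mem_gridSet, some_mem_gridSet, ind,
        Set.mem_inter_iff]
    · grind
    have := i.2
    have := j.2
    grind (splits := 20)

theorem isSaturated_grid_zero (hr : IsParityEquitable (gridPlusOne w h) r) (hh : 3 ≤ h)
    (hw : h < w) : IsSaturated r (gridSet w h False fun i j => i = 0 ∧ j = 0) := by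
  have h0 := isSaturated_grid_row hr hh hw (h - 1) (by omega)
  refine ((h0.oddNeighbors hr).inter (isSaturated_grid_origin hr hh hw)).gridSet
    ?_ fun i j => ?_ <;>
    simp only [gridSet_oddNeighbors, none_mem_gridSet, some_mem_gridSet, ind, Set.mem_inter_iff]
  · grind
  have := i.2
  have := j.2
  grind (splits := 20)

theorem isSaturated_grid_none (hr : IsParityEquitable (gridPlusOne w h) r) (hh : 3 ≤ h)
    (hw : h < w) : IsSaturated r (gridSet w h True fun _ _ => False) := by
  have h0 := isSaturated_grid_zero hr hh hw
  refine ((h0.oddNeighbors hr).inter (isSaturated_grid_origin hr hh hw)).gridSet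
    ?_ fun i j => ?_ <;>
    simp only [gridSet_oddNeighbors, none_mem_gridSet, some_mem_gridSet, ind, Set.mem_inter_iff]
  · grind
  have := i.2
  have := j.2
  grind (splits := 20)

theorem isSaturated_grid_first_column (hr : IsParityEquitable (gridPlusOne w h) r) (hh : 3 ≤ h)
    (hw : h < w) (b : ℕ) : IsSaturated r (gridSet w h False fun i j => i = 0 ∧ j = b) := by
  have hlt : ∀ b < h, IsSaturated r (gridSet w h False fun i j => i = 0 ∧ j = b) := by
    intro b hb
    by_cases hb0 : b = 0
    · subst hb0
      exact isSaturated_grid_zero hr hh hw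
    · refine ((isSaturated_grid_pair hr hh hw (b - 1) (by omega)).diff
        (isSaturated_grid_row hr hh hw (h - b) (by omega))).gridSet ?_ fun i j => ?_ <;>
        simp only [none_mem_gridSet, some_mem_gridSet, Set.mem_sdiff]
      · grind
      · grind
  by_cases hb : b < h
  · exact hlt b hb
  by_cases hb' : h < b
  · refine (IsSaturated.univ.diff IsSaturated.univ).gridSet (by simp) fun i j => ?_
    have := j.2
    simp only [Set.sdiff_self, Set.mem_empty_iff_false, iff_false]
    omega
  obtain rfl : b = h := by omega
  have hpair : IsSaturated r (gridSet w b False fun i j =>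
      (i = 0 ∧ j = b) ∨ (i = 1 ∧ j + 1 = b)) := by
    refine (((hlt (b - 1) (by omega)).oddNeighbors hr).diff (hlt (b - 2) (by omega))).gridSet
      ?_ fun i j => ?_ <;>
      simp only [gridSet_oddNeighbors, none_mem_gridSet, some_mem_gridSet, ind, Set.mem_sdiff]
    · grind
    have := i.2
    have := j.2
    grind (splits := 20)
  have h1 : IsSaturated r (gridSet w b False fun i j => i = 1 ∧ j + 2 = b) := by
    refine ((((hlt (b - 2) (by omega)).oddNeighbors hr).diff (hlt (b - 3) (by omega))).diff
      (hlt (b - 1) (by omega))).gridSet ?_ fun i j => ?_ <;>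
      simp only [gridSet_oddNeighbors, none_mem_gridSet, some_mem_gridSet, ind, Set.mem_sdiff]
    · grind
    have := i.2
    have := j.2
    grind (splits := 20)
  -- The corner `u_{0,b}` is not in the border set, so it is reached as a neighbour of `u_{0,b-1}`;
  -- the other candidate `u_{1,b-1}` is removed as a neighbour of `u_{1,b-2}`.
  refine (hpair.diff (h1.oddNeighbors hr)).gridSet ?_ fun i j => ?_ <;>
    simp only [gridSet_oddNeighbors, none_mem_gridSet, some_mem_gridSet, ind, Set.mem_sdiff]
  · grind
  have := i.2
  have := j.2
  grind (splits := 20)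

theorem isSaturated_grid_some (hr : IsParityEquitable (gridPlusOne w h) r) (hh : 3 ≤ h)
    (hw : h < w) (a b : ℕ) : IsSaturated r (gridSet w h False fun i j => i = a ∧ j = b) := by
  induction a using Nat.strong_induction_on generalizing b with | _ a ih
  match a with
  | 0 => exact isSaturated_grid_first_column hr hh hw b
  | a + 1 =>
    -- Of the neighbours of `u_{a,b}`, only `u_{a+1,b}` remains. At the boundary, truncated
    -- subtraction makes `b - 1` or `a - 1` give `u_{a,b}` itself, which is not its own neighbour,
    -- and `b + 1 > h` gives the empty set, so the removals stay harmless.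
    refine ((((((ih a (by omega) b).oddNeighbors hr).diff (ih a (by omega) (b + 1))).diff
      (ih a (by omega) (b - 1))).diff (ih (a - 1) (by omega) b)).diff
      (isSaturated_grid_none hr hh hw)).gridSet ?_ fun i j => ?_ <;>
      simp only [gridSet_oddNeighbors, none_mem_gridSet, some_mem_gridSet, ind, Set.mem_sdiff]
    · grind
    have := i.2
    have := j.2
    grind (splits := 20)

theorem isParityRigid_gridPlusOne (hh : 3 ≤ h) (hw : h < w) :
    IsParityRigid (gridPlusOne w h) := by
  refine isParityRigid_of_singleton fun r hr u => ?_
  rcases u with _ | ⟨a, b⟩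
  · convert isSaturated_grid_none hr hh hw using 1
    ext (_ | ⟨i, j⟩)
    · simp [none_mem_gridSet]
    · simp [some_mem_gridSet]
  · convert isSaturated_grid_some hr hh hw a b using 1
    ext (_ | ⟨i, j⟩)
    · simp [none_mem_gridSet]
    · simp [some_mem_gridSet, Fin.ext_iff]

end Grid

/-! ### Subdivisions -/

theorem IsParityRigid.of_iso {V V' : Type*} {G : SimpleGraph V} {G' : SimpleGraph V'}
    (φ : G ≃g G') (h : IsParityRigid G') : IsParityRigid G := by
  intro r hr u v huv
  have key : IsParityEquitable G' (r.comap φ.symm) := by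
    have hcard : ∀ a c, {x | G'.Adj a x ∧ r.comap φ.symm x c}.ncard =
        {x | G.Adj (φ.symm a) x ∧ r x (φ.symm c)}.ncard := by
      intro a c
      rw [← Set.ncard_image_of_injective _ φ.symm.injective]
      congr 1
      ext x
      simp only [Set.mem_image, Set.mem_ofPred_eq]
      constructor
      · rintro ⟨y, ⟨hy, hc⟩, rfl⟩
        exact ⟨φ.symm.map_adj_iff.2 hy, hc⟩
      · rintro ⟨hx, hc⟩
        refine ⟨φ x, ⟨?_, ?_⟩, φ.symm_apply_apply x⟩
        · rw [← φ.symm.map_adj_iff, φ.symm_apply_apply]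
          exact hx
        · rw [Setoid.comap_rel, φ.symm_apply_apply]
          exact hc
    intro a b c hab
    rw [hcard, hcard]
    exact hr _ _ _ hab
  refine φ.injective (h _ key (φ u) (φ v) ?_)
  rw [Setoid.comap_rel, φ.symm_apply_apply, φ.symm_apply_apply]
  exact huv

theorem mem_oddNeighbors_singleton {V : Type*} {G : SimpleGraph V} {u v : V} :
    u ∈ oddNeighbors G {v} ↔ G.Adj u v := by
  rw [oddNeighbors, Set.mem_ofPred_eq]
  by_cases h : G.Adj u v
  · have : {x | G.Adj u x ∧ x ∈ ({v} : Set V)} = {v} := by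
      ext x
      simp only [Set.mem_ofPred_eq, Set.mem_singleton_iff, and_iff_right_iff_imp]
      rintro rfl
      exact h
    rw [this]
    simp [h]
  · have : {x | G.Adj u x ∧ x ∈ ({v} : Set V)} = ∅ := by
      ext x
      simp only [Set.mem_ofPred_eq, Set.mem_singleton_iff, Set.mem_empty_iff_false, iff_false]
      rintro ⟨hx, rfl⟩
      exact h hx
    rw [this]
    simp [h]

theorem mem_oddNeighbors_of_pair {V : Type*} {G : SimpleGraph V} {s : Set V} {u a b : V}
    (hab : a ≠ b) (h : ∀ x, G.Adj u x ↔ x = a ∨ x = b) :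
    u ∈ oddNeighbors G s ↔ ¬(a ∈ s ↔ b ∈ s) := by
  have hset : {x | G.Adj u x ∧ x ∈ s} = {a, b} ∩ s := by
    ext x
    simp only [Set.mem_ofPred_eq, h, Set.mem_inter_iff, Set.mem_insert_iff, Set.mem_singleton_iff]
  rw [oddNeighbors, Set.mem_ofPred_eq, hset]
  by_cases ha : a ∈ s <;> by_cases hb : b ∈ s <;>
    simp [Set.insert_inter_of_mem, Set.insert_inter_of_notMem, ha, hb, Set.ncard_pair hab]

/-! ### Neighbourhoods in a subdivided graph -/

namespace Subdivision

variable {W : Type*} {H : SimpleGraph W} (D : Subdivision H)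

theorem pathVertex_succ {e : H.edgeSet} {j : ℕ} (h : j < D.len e) :
    D.pathVertex e (j + 1) = Sum.inr ⟨e, ⟨j, h⟩⟩ := dif_pos h

theorem pathVertex_last (e : H.edgeSet) : D.pathVertex e (D.len e + 1) = Sum.inl (D.tgt e) :=
  dif_neg (lt_irrefl _)

theorem src_ne_tgt (e : H.edgeSet) : D.src e ≠ D.tgt e := by
  have h := e.2
  rw [← D.ends e] at h
  exact (H.mem_edgeSet.1 h).ne

theorem pathVertex_eq_inr {e e' : H.edgeSet} {i : ℕ} {j : Fin (D.len e')} :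
    D.pathVertex e i = Sum.inr ⟨e', j⟩ ↔ e = e' ∧ i = j + 1 := by
  constructor
  · cases i with
    | zero => intro h; exact absurd h (by simp [pathVertex])
    | succ i =>
      by_cases hi : i < D.len e
      · rw [D.pathVertex_succ hi]
        intro h
        cases h
        exact ⟨rfl, rfl⟩
      · intro h
        rw [pathVertex, dif_neg hi] at h
        cases h
  · rintro ⟨rfl, rfl⟩
    exact D.pathVertex_succ j.2

theorem pathVertex_eq_inl {e : H.edgeSet} {i : ℕ} {w : W} :
    D.pathVertex e i = Sum.inl w ↔ (i = 0 ∧ D.src e = w) ∨ (D.len e < i ∧ D.tgt e = w) := by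
  cases i with
  | zero => simp [pathVertex]
  | succ i =>
    by_cases hi : i < D.len e
    · simp [D.pathVertex_succ hi]
      omega
    · rw [pathVertex, dif_neg hi]
      have : D.len e < i + 1 := by omega
      simp [this]

theorem adj_inr {e : H.edgeSet} {j : Fin (D.len e)} {x : D.Vertex} :
    D.graph.Adj (Sum.inr ⟨e, j⟩) x ↔ x = D.pathVertex e j ∨ x = D.pathVertex e (j + 2) := by
  rw [graph, SimpleGraph.fromEdgeSet_adj]
  constructor
  · rintro ⟨⟨e', i, hi, h⟩, hne⟩
    rcases Sym2.eq_iff.1 h with ⟨h1, h2⟩ | ⟨h1, h2⟩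
    · obtain ⟨rfl, rfl⟩ := D.pathVertex_eq_inr.1 h1.symm
      exact Or.inr h2
    · obtain ⟨rfl, h3⟩ := D.pathVertex_eq_inr.1 h1.symm
      obtain rfl : i = j := by omega
      exact Or.inl h2
  · have hj := j.2
    rintro (rfl | rfl)
    · refine ⟨⟨e, j, by omega, ?_⟩, fun h => ?_⟩
      · rw [D.pathVertex_succ hj, Sym2.eq_swap]
      · have := (D.pathVertex_eq_inr.1 h.symm).2
        omega
    · refine ⟨⟨e, j + 1, by omega, ?_⟩, fun h => ?_⟩
      · rw [D.pathVertex_succ hj]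
      · have := (D.pathVertex_eq_inr.1 h.symm).2
        omega

theorem pathVertex_ne_pathVertex_add_two {e : H.edgeSet} {j : ℕ} (hj : j < D.len e) :
    D.pathVertex e j ≠ D.pathVertex e (j + 2) := by
  intro h
  by_cases hj2 : j + 1 < D.len e
  · rw [D.pathVertex_succ hj2] at h
    have := (D.pathVertex_eq_inr.1 h).2
    exact absurd this (by simp only; omega)
  · obtain hj3 : j + 2 = D.len e + 1 := by omega
    rw [hj3, D.pathVertex_last] at h
    rcases D.pathVertex_eq_inl.1 h with h | h
    · exact D.src_ne_tgt e h.2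
    · omega

theorem inr_mem_oddNeighbors {s : Set D.Vertex} {e : H.edgeSet} {j : Fin (D.len e)} :
    Sum.inr ⟨e, j⟩ ∈ oddNeighbors D.graph s ↔
      ¬(D.pathVertex e j ∈ s ↔ D.pathVertex e (j + 2) ∈ s) :=
  mem_oddNeighbors_of_pair (D.pathVertex_ne_pathVertex_add_two j.2) fun _ => D.adj_inr

open Classical in
/-- The first vertex after `w` on the path that replaces an edge `e` with the end `w`. -/
noncomputable def next (w : W) (e : H.edgeSet) : D.Vertex :=
  if D.src e = w then D.pathVertex e 1 else D.pathVertex e (D.len e)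

theorem eq_src_or_eq_tgt {w : W} {e : H.edgeSet} (hw : w ∈ (e : Sym2 W)) :
    D.src e = w ∨ D.tgt e = w := by
  rw [← D.ends e, Sym2.mem_iff] at hw
  exact hw.imp Eq.symm Eq.symm

theorem adj_inl {w : W} {x : D.Vertex} :
    D.graph.Adj (Sum.inl w) x ↔ ∃ e : H.edgeSet, w ∈ (e : Sym2 W) ∧ D.next w e = x := by
  rw [graph, SimpleGraph.fromEdgeSet_adj]
  constructor
  · rintro ⟨⟨e, i, hi, h⟩, hne⟩
    refine ⟨e, ?_⟩
    rw [← D.ends e, Sym2.mem_iff, next]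
    rcases Sym2.eq_iff.1 h with ⟨h1, h2⟩ | ⟨h1, h2⟩
    · rcases D.pathVertex_eq_inl.1 h1.symm with ⟨rfl, rfl⟩ | h3
      · exact ⟨Or.inl rfl, by rw [if_pos rfl, h2]⟩
      · omega
    · rcases D.pathVertex_eq_inl.1 h1.symm with ⟨h3, _⟩ | ⟨h3, rfl⟩
      · omega
      · obtain rfl : i = D.len e := by omega
        exact ⟨Or.inr rfl, by rw [if_neg (D.src_ne_tgt e), h2]⟩
  · rintro ⟨e, hw, rfl⟩
    have hne := D.src_ne_tgt e
    rw [next]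
    rcases D.eq_src_or_eq_tgt hw with rfl | rfl
    · rw [if_pos rfl]
      refine ⟨⟨e, 0, by omega, rfl⟩, fun h => ?_⟩
      rcases D.pathVertex_eq_inl.1 h.symm with h | h
      · omega
      · exact hne h.2.symm
    · rw [if_neg hne]
      refine ⟨⟨e, D.len e, le_rfl, ?_⟩, fun h => ?_⟩
      · rw [D.pathVertex_last, Sym2.eq_swap]
      · rcases D.pathVertex_eq_inl.1 h.symm with h | h
        · exact hne h.2
        · omega

/-- A new vertex determines its edge; if both edges are kept, the next vertex is the other end,
which determines the edge because `H` is simple. So neighbours of `w` can be counted by edges of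
`H`. -/
theorem next_injOn (w : W) : Set.InjOn (D.next w) {e | w ∈ (e : Sym2 W)} := by
  have key : ∀ e e' : H.edgeSet, w ∈ (e : Sym2 W) → w ∈ (e' : Sym2 W) →
      D.next w e = D.next w e' → 0 < D.len e → e = e' := by
    intro e e' he he' h hlen
    obtain ⟨j, hj⟩ : ∃ j, D.next w e = Sum.inr ⟨e, j⟩ := by
      rw [next]
      split_ifs
      · exact ⟨_, D.pathVertex_succ hlen⟩
      · refine ⟨⟨D.len e - 1, by omega⟩, D.pathVertex_eq_inr.2 ⟨rfl, ?_⟩⟩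
        simp only
        omega
    rw [hj, next] at h
    split_ifs at h
    · exact (D.pathVertex_eq_inr.1 h.symm).1.symm
    · exact (D.pathVertex_eq_inr.1 h.symm).1.symm
  have hzero : ∀ e : H.edgeSet, w ∈ (e : Sym2 W) → D.len e = 0 →
      ∃ x, D.next w e = Sum.inl x ∧ (e : Sym2 W) = s(w, x) := by
    intro e he hlen
    rw [next]
    rcases D.eq_src_or_eq_tgt he with rfl | rfl
    · refine ⟨D.tgt e, ?_, (D.ends e).symm⟩
      rw [if_pos rfl, D.pathVertex_eq_inl]
      exact Or.inr ⟨by omega, rfl⟩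
    · refine ⟨D.src e, ?_, ?_⟩
      · rw [if_neg (D.src_ne_tgt e), hlen]
        rfl
      · rw [Sym2.eq_swap, D.ends e]
  intro e he e' he' h
  by_cases h1 : 0 < D.len e
  · exact key e e' he he' h h1
  by_cases h2 : 0 < D.len e'
  · exact (key e' e he' he h.symm h2).symm
  obtain ⟨x, hx, hex⟩ := hzero e he (by omega)
  obtain ⟨x', hx', hex'⟩ := hzero e' he' (by omega)
  rw [hx, hx'] at h
  obtain rfl := Sum.inl_injective h
  exact Subtype.ext (hex.trans hex'.symm)

theorem inl_mem_oddNeighbors {s : Set D.Vertex} {w : W} :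
    Sum.inl w ∈ oddNeighbors D.graph s ↔
      Odd {e : H.edgeSet | w ∈ (e : Sym2 W) ∧ D.next w e ∈ s}.ncard := by
  have hinj : Set.InjOn (D.next w) {e : H.edgeSet | w ∈ (e : Sym2 W) ∧ D.next w e ∈ s} :=
    (D.next_injOn w).mono fun e he => he.1
  rw [oddNeighbors, Set.mem_ofPred_eq, ← hinj.ncard_image]
  refine iff_of_eq (congrArg (fun t => Odd (Set.ncard t)) ?_)
  ext x
  simp only [Set.mem_ofPred_eq, D.adj_inl, Set.mem_image]
  constructor
  · rintro ⟨⟨e, hw, rfl⟩, hx⟩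
    exact ⟨e, ⟨hw, hx⟩, rfl⟩
  · rintro ⟨e, ⟨hw, hx⟩, rfl⟩
    exact ⟨⟨e, hw, rfl⟩, hx⟩

theorem inl_mem_oddNeighbors_of_unique {s : Set D.Vertex} {w : W} {e : H.edgeSet}
    (h : ∀ e' : H.edgeSet, w ∈ (e' : Sym2 W) → (D.next w e' ∈ s ↔ e' = e)) :
    Sum.inl w ∈ oddNeighbors D.graph s ↔ w ∈ (e : Sym2 W) := by
  rw [D.inl_mem_oddNeighbors]
  by_cases hw : w ∈ (e : Sym2 W)
  · have : {e' : H.edgeSet | w ∈ (e' : Sym2 W) ∧ D.next w e' ∈ s} = {e} := by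
      ext e'
      simp only [Set.mem_ofPred_eq, Set.mem_singleton_iff]
      exact ⟨fun he => (h e' he.1).1 he.2, fun he => by subst he; exact ⟨hw, (h e' hw).2 rfl⟩⟩
    simp [this, hw]
  · have : {e' : H.edgeSet | w ∈ (e' : Sym2 W) ∧ D.next w e' ∈ s} = ∅ := by
      ext e'
      simp only [Set.mem_ofPred_eq, Set.mem_empty_iff_false, iff_false]
      rintro ⟨h1, h2⟩
      exact hw ((h e' h1).1 h2 ▸ h1)
    simp [this, hw]

/-- The set of the vertices of the original graph. -/
def baseSet : Set D.Vertex := {x | Sum.elim (fun _ : W => True) (fun _ => False) x}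

/-- The set of the new vertices whose edge `e` and position `1, …, len e` satisfy `P`. -/
def interiorSet (P : H.edgeSet → ℕ → Prop) : Set D.Vertex :=
  {x | Sum.elim (fun _ : W => False) (fun y : Σ e, Fin (D.len e) => P y.1 (y.2 + 1)) x}

theorem inl_mem_baseSet {w : W} : Sum.inl w ∈ D.baseSet ↔ True := Iff.rfl

theorem inr_mem_baseSet {e : H.edgeSet} {j : Fin (D.len e)} :
    Sum.inr ⟨e, j⟩ ∈ D.baseSet ↔ False := Iff.rfl

theorem inl_mem_interiorSet {P : H.edgeSet → ℕ → Prop} {w : W} :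
    Sum.inl w ∈ D.interiorSet P ↔ False := Iff.rfl

theorem inr_mem_interiorSet {P : H.edgeSet → ℕ → Prop} {e : H.edgeSet} {j : Fin (D.len e)} :
    Sum.inr ⟨e, j⟩ ∈ D.interiorSet P ↔ P e (j + 1) := Iff.rfl

theorem pathVertex_mem_interiorSet {P : H.edgeSet → ℕ → Prop} {e : H.edgeSet} {i : ℕ} :
    D.pathVertex e i ∈ D.interiorSet P ↔ 0 < i ∧ i ≤ D.len e ∧ P e i := by
  cases i with
  | zero => simp [pathVertex, inl_mem_interiorSet]
  | succ i =>
    by_cases hi : i < D.len e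
    · rw [D.pathVertex_succ hi, inr_mem_interiorSet]
      simp [hi]
    · rw [pathVertex, dif_neg hi, inl_mem_interiorSet]
      simp [hi]

theorem pathVertex_mem_baseSet {e : H.edgeSet} {i : ℕ} :
    D.pathVertex e i ∈ D.baseSet ↔ i = 0 ∨ D.len e < i := by
  cases i with
  | zero => simp [pathVertex, inl_mem_baseSet]
  | succ i =>
    by_cases hi : i < D.len e
    · rw [D.pathVertex_succ hi, inr_mem_baseSet]
      simp
      omega
    · rw [pathVertex, dif_neg hi, inl_mem_baseSet]
      simp
      omega

variable {D} {r : Setoid D.Vertex}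

theorem _root_.QAOA.IsSaturated.interiorSet {s : Set D.Vertex} (h : IsSaturated r s)
    {P : H.edgeSet → ℕ → Prop} (h0 : ∀ w, Sum.inl w ∉ s)
    (hP : ∀ (e : H.edgeSet) (j : Fin (D.len e)), P e (j + 1) ↔ Sum.inr ⟨e, j⟩ ∈ s) :
    IsSaturated r (D.interiorSet P) := by
  convert h using 1
  ext (w | ⟨e, j⟩)
  · simp [inl_mem_interiorSet, h0 w]
  · exact hP e j

theorem incident_ncard (w : W) :
    {e : H.edgeSet | w ∈ (e : Sym2 W)}.ncard = (H.neighborSet w).ncard := by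
  rw [← Set.ncard_image_of_injective _ Subtype.val_injective,
    ← Set.ncard_image_of_injective (H.neighborSet w) fun x y h => Sym2.congr_right.mp h]
  congr 1
  ext e
  constructor
  · rintro ⟨⟨e, he⟩, ⟨x, rfl⟩, rfl⟩
    exact ⟨x, he, rfl⟩
  · rintro ⟨x, hx, rfl⟩
    exact ⟨⟨s(w, x), hx⟩, Sym2.mem_mk_left w x, rfl⟩

theorem IsAsymmetric.eq_of_len_eq (hD : D.IsAsymmetric) {e e' : H.edgeSet}
    (h : D.len e = D.len e') : e = e' := by
  by_cases he : 1 ≤ D.len e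
  · exact hD.2 he (show 1 ≤ D.len e' by omega) h
  · exact Set.encard_le_one_iff.1 hD.1 e e' he (show ¬1 ≤ D.len e' by omega)

theorem next_mem_interiorSet {P : H.edgeSet → ℕ → Prop} {w : W} {e : H.edgeSet}
    (hP : P e 1 ↔ P e (D.len e)) :
    D.next w e ∈ D.interiorSet P ↔ 1 ≤ D.len e ∧ P e 1 := by
  rw [next]
  split_ifs <;> rw [pathVertex_mem_interiorSet] <;> grind

/-! ### Parity-rigidity of asymmetric subdivisions of odd graphs -/

section

variable [Finite W]

/-- Original vertices keep their odd degree, while new vertices have degree 2. -/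
theorem isSaturated_baseSet (hH : ∀ w, Odd (H.neighborSet w).ncard)
    (hr : IsParityEquitable D.graph r) : IsSaturated r D.baseSet := by
  convert (IsSaturated.univ (r := r)).oddNeighbors hr using 1
  ext (w | ⟨e, j⟩)
  · simp only [inl_mem_baseSet, D.inl_mem_oddNeighbors, Set.mem_univ, and_true, true_iff,
      incident_ncard]
    exact hH w
  · simp [inr_mem_baseSet, D.inr_mem_oddNeighbors]

/-- The set of the new vertices at a given distance from the nearer end of their path, with
middle vertices excluded, is saturated. -/
theorem isSaturated_level (hr : IsParityEquitable D.graph r) (hW : IsSaturated r D.baseSet)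
    (m : ℕ) : IsSaturated r (D.interiorSet fun e p =>
      2 * (m + 1) ≤ D.len e ∧ (p = m + 1 ∨ p + m = D.len e)) := by
  induction m using Nat.strong_induction_on with | _ m ih
  match m with
  | 0 =>
    refine ((hW.oddNeighbors hr).diff hW).interiorSet (fun w => ?_) fun e j => ?_
    · simp [inl_mem_baseSet]
    · have := j.2
      simp only [Set.mem_sdiff, D.inr_mem_oddNeighbors, inr_mem_baseSet, pathVertex_mem_baseSet]
      grind
  | 1 =>
    have h0 := ih 0 (by omega)
    -- A middle vertex has both neighbours in the previous level and drops out by parity. Removing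
    -- `h0` matters on paths with two new vertices, which are adjacent and both in `h0`.
    refine (((h0.oddNeighbors hr).diff h0).diff hW).interiorSet (fun w => ?_) fun e j => ?_
    · simp [inl_mem_baseSet]
    · have := j.2
      simp only [Set.mem_sdiff, D.inr_mem_oddNeighbors, inr_mem_baseSet, inr_mem_interiorSet,
        pathVertex_mem_interiorSet]
      grind
  | m + 2 =>
    have h0 := ih (m + 1) (by omega)
    have h1 := ih m (by omega)
    refine ((((h0.oddNeighbors hr).diff h0).diff h1).diff hW).interiorSet (fun w => ?_)
      fun e j => ?_
    · simp [inl_mem_baseSet]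
    · have := j.2
      simp only [Set.mem_sdiff, D.inr_mem_oddNeighbors, inr_mem_baseSet, inr_mem_interiorSet,
        pathVertex_mem_interiorSet]
      grind

theorem isSaturated_middle (hr : IsParityEquitable D.graph r) (hW : IsSaturated r D.baseSet) :
    IsSaturated r (D.interiorSet fun e p => 2 * p = D.len e + 1) := by
  have h := IsSaturated.iInter fun m => IsSaturated.univ.diff (isSaturated_level hr hW m)
  refine (h.diff hW).interiorSet (fun w => ?_) fun e j => ?_
  · simp [inl_mem_baseSet]
  · have := j.2
    simp only [Set.mem_sdiff, Set.mem_iInter, Set.mem_univ, true_and, inr_mem_baseSet,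
      inr_mem_interiorSet, not_false_eq_true, and_true]
    constructor
    · intro h m
      omega
    · intro h
      -- For the position `p = j + 1`, the levels to exclude are those of its distances to the two
      -- ends, `p` and `len e + 1 - p`.
      have h1 := h j
      have h2 := h (D.len e - (j + 1))
      omega

/-- The length of a path is visible at its centre: at level `m`, having a neighbour in the same
level means length `2(m + 1)`, and being next to a middle vertex means length `2(m + 1) + 1`. The
induction on `k` carries this information outwards from the centre. -/
theorem isSaturated_level_of_len (hr : IsParityEquitable D.graph r)
    (hW : IsSaturated r D.baseSet) (l m k : ℕ) (hl : l = 2 * (m + 1) + k) :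
    IsSaturated r (D.interiorSet fun e p => D.len e = l ∧ (p = m + 1 ∨ p + m = l)) := by
  induction k using Nat.strong_induction_on generalizing m with | _ k ih
  have h0 := isSaturated_level hr hW m
  match k with
  | 0 =>
    refine (h0.inter (h0.oddNeighbors hr)).interiorSet (fun w => ?_) fun e j => ?_
    · simp [inl_mem_interiorSet]
    · have := j.2
      simp only [Set.mem_inter_iff, D.inr_mem_oddNeighbors, inr_mem_interiorSet,
        pathVertex_mem_interiorSet]
      grind
  | 1 =>
    refine (h0.inter ((isSaturated_middle hr hW).oddNeighbors hr)).interiorSet (fun w => ?_)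
      fun e j => ?_
    · simp [inl_mem_interiorSet]
    · have := j.2
      simp only [Set.mem_inter_iff, D.inr_mem_oddNeighbors, inr_mem_interiorSet,
        pathVertex_mem_interiorSet]
      grind
  | k + 2 =>
    have h1 := ih k (by omega) (m + 1) (by omega)
    refine (h0.inter (h1.oddNeighbors hr)).interiorSet (fun w => ?_) fun e j => ?_
    · simp [inl_mem_interiorSet]
    · have := j.2
      simp only [Set.mem_inter_iff, D.inr_mem_oddNeighbors, inr_mem_interiorSet,
        pathVertex_mem_interiorSet]
      grind

/-- The pair of the ends of any edge of the original graph is saturated. -/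
theorem isSaturated_ends (hD : D.IsAsymmetric) (hr : IsParityEquitable D.graph r)
    (hW : IsSaturated r D.baseSet) (e : H.edgeSet) :
    IsSaturated r (Sum.inl '' {w | w ∈ (e : Sym2 W)}) := by
  -- It suffices to find a saturated set met by the first step into a path exactly when the path has
  -- length `len e`; by asymmetry only `e` qualifies. It is a level set for `len e ≥ 2`, the middle
  -- vertices for `len e = 1`, and the original vertices for `len e = 0`.
  have key : ∀ s, IsSaturated r s →
      (∀ (e' : H.edgeSet) (w : W), w ∈ (e' : Sym2 W) → (D.next w e' ∈ s ↔ D.len e' = D.len e)) →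
      IsSaturated r (Sum.inl '' {w | w ∈ (e : Sym2 W)}) := by
    intro s hs h
    convert (hs.oddNeighbors hr).inter hW using 1
    ext (w | ⟨e', j⟩)
    · rw [Set.mem_inter_iff, inl_mem_baseSet, and_true,
        D.inl_mem_oddNeighbors_of_unique (e := e) fun e' he' =>
          (h e' w he').trans ⟨hD.eq_of_len_eq, fun h => by rw [h]⟩]
      simp
    · simp [inr_mem_baseSet]
  rcases Nat.lt_or_ge 1 (D.len e) with he | he
  · refine key _ (isSaturated_level_of_len hr hW (D.len e) 0 (D.len e - 2) (by omega))
      fun e' w _ => ?_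
    rw [next_mem_interiorSet (by omega)]
    omega
  · rcases Nat.lt_or_ge 0 (D.len e) with he' | he'
    · refine key _ (isSaturated_middle hr hW) fun e' w _ => ?_
      rw [next_mem_interiorSet (by omega)]
      omega
    · refine key _ hW fun e' w _ => ?_
      rw [next]
      split_ifs <;> rw [pathVertex_mem_baseSet] <;> omega

/-- Connectedness and a third vertex provide an edge leaving `{w, b}`. Its pair of ends meets `{w,
b}` in one vertex, which is thereby isolated; the other is the difference. -/
theorem isSaturated_inl (hD : D.IsAsymmetric) (hH : H.Connected) (hcard : 3 ≤ Nat.card W)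
    (hr : IsParityEquitable D.graph r) (hW : IsSaturated r D.baseSet) (w : W) :
    IsSaturated r {(Sum.inl w : D.Vertex)} := by
  have hex : ∀ s : Set W, s.Nonempty → s.ncard < Nat.card W → ∃ a ∈ s, ∃ b ∉ s, H.Adj a b := by
    rintro s ⟨a, ha⟩ hs
    obtain ⟨b, hb⟩ : ∃ b, b ∉ s := by
      by_contra! h
      rw [Set.eq_univ_of_forall h, Set.ncard_univ] at hs
      exact lt_irrefl _ hs
    obtain ⟨p⟩ := hH.preconnected a b
    obtain ⟨d, _, hd, hd'⟩ := p.exists_boundary_dart s ha hb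
    exact ⟨_, hd, _, hd', d.adj⟩
  obtain ⟨w', hw', b, _, hwb⟩ := hex {w} ⟨w, rfl⟩ (by rw [Set.ncard_singleton]; omega)
  rw [Set.mem_singleton_iff.1 hw'] at hwb
  have hends : ∀ {x y : W}, H.Adj x y →
      IsSaturated r {(Sum.inl x : D.Vertex), Sum.inl y} := by
    intro x y hxy
    convert isSaturated_ends hD hr hW ⟨s(x, y), hxy⟩ using 1
    ext z
    simp [eq_comm]
  have hpair : ({w, b} : Set W).ncard < Nat.card W := by
    rw [Set.ncard_pair hwb.ne]
    omega
  obtain ⟨a, ha, c, hc, hac⟩ := hex {w, b} ⟨w, by simp⟩ hpair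
  simp only [Set.mem_insert_iff, Set.mem_singleton_iff, not_or] at hc
  have h1 := hends hwb
  have hsingle : IsSaturated r {(Sum.inl a : D.Vertex)} := by
    convert h1.inter (hends hac) using 1
    ext z
    simp only [Set.mem_inter_iff, Set.mem_insert_iff, Set.mem_singleton_iff]
    constructor
    · rintro rfl
      rcases ha with rfl | rfl <;> simp
    · rintro ⟨h2, rfl | rfl⟩
      · rfl
      · simp [hc.1, hc.2] at h2
  rcases ha with rfl | rfl
  · exact hsingle
  · convert h1.diff hsingle using 1
    ext z
    simp only [Set.mem_sdiff, Set.mem_insert_iff, Set.mem_singleton_iff]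
    constructor
    · rintro rfl
      simp [hwb.ne]
    · tauto

theorem isSaturated_pathVertex (hD : D.IsAsymmetric) (hH : H.Connected)
    (hcard : 3 ≤ Nat.card W) (hr : IsParityEquitable D.graph r)
    (hW : IsSaturated r D.baseSet) (e : H.edgeSet) (i : ℕ) (hi : i ≤ D.len e) :
    IsSaturated r {D.pathVertex e i} := by
  induction i using Nat.strong_induction_on with | _ i ih
  match i with
  | 0 => exact isSaturated_inl hD hH hcard hr hW _
  | 1 =>
    have hne := D.src_ne_tgt e
    -- The set `s` excludes the neighbours of `src e` on other paths, and starting from `src e`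
    -- alone fixes the orientation of the path.
    have key : ∀ s, IsSaturated r s → (∀ w, Sum.inl w ∉ s) →
        (∀ (e' : H.edgeSet) (j : Fin (D.len e')), Sum.inr ⟨e', j⟩ ∈ s →
          (j : ℕ) = 0 ∨ (j : ℕ) + 1 = D.len e' → e' = e) →
        D.pathVertex e 1 ∈ s → IsSaturated r {D.pathVertex e 1} := by
      intro s hs hs0 hse hs1
      have h1 := (isSaturated_inl hD hH hcard hr hW (D.src e)).oddNeighbors hr
      convert h1.inter hs using 1
      ext (w | ⟨e', j⟩)
      · simp only [Set.mem_singleton_iff, Set.mem_inter_iff, hs0, and_false, iff_false]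
        intro h
        exact hs0 w (h ▸ hs1)
      · rw [Set.mem_inter_iff, mem_oddNeighbors_singleton, D.adj_inr, Set.mem_singleton_iff,
          eq_comm, D.pathVertex_eq_inr]
        have hj := j.2
        constructor
        · rintro ⟨rfl, h⟩
          obtain hj0 : (j : ℕ) = 0 := by omega
          refine ⟨Or.inl (by rw [hj0]; rfl), ?_⟩
          rwa [← D.pathVertex_succ hj, hj0]
        · rintro ⟨h, hjs⟩
          have h2 : (j : ℕ) = 0 ∨ (j : ℕ) + 1 = D.len e' := by
            rcases h with h | h
            · rcases D.pathVertex_eq_inl.1 h.symm with h | h <;> omega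
            · rcases D.pathVertex_eq_inl.1 h.symm with h | h <;> omega
          obtain rfl := hse e' j hjs h2
          refine ⟨rfl, ?_⟩
          rcases h with h | h
          · rcases D.pathVertex_eq_inl.1 h.symm with h | h <;> omega
          · rcases D.pathVertex_eq_inl.1 h.symm with h | h
            · omega
            · exact absurd h.2.symm hne
    by_cases he : D.len e = 1
    · refine key _ (isSaturated_middle hr hW) (fun w => by simp [inl_mem_interiorSet])
        (fun e' j hj hj' => hD.eq_of_len_eq ?_) ?_
      · rw [inr_mem_interiorSet] at hj
        omega
      · rw [pathVertex_mem_interiorSet]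
        omega
    · refine key _ (isSaturated_level_of_len hr hW (D.len e) 0 (D.len e - 2) (by omega))
        (fun w => by simp [inl_mem_interiorSet]) (fun e' j hj hj' => hD.eq_of_len_eq ?_) ?_
      · rw [inr_mem_interiorSet] at hj
        exact hj.1
      · rw [pathVertex_mem_interiorSet]
        omega
  | i + 2 =>
    have h0 := ih i (by omega) (by omega)
    have h1 := (ih (i + 1) (by omega) (by omega)).oddNeighbors hr
    have hi' : i < D.len e := by omega
    convert h1.diff h0 using 1
    ext x
    rw [Set.mem_sdiff, mem_oddNeighbors_singleton, D.pathVertex_succ hi', SimpleGraph.adj_comm,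
      D.adj_inr, Set.mem_singleton_iff, Set.mem_singleton_iff]
    constructor
    · rintro rfl
      exact ⟨Or.inr rfl, (D.pathVertex_ne_pathVertex_add_two hi').symm⟩
    · rintro ⟨h | h, h'⟩
      · exact absurd h h'
      · exact h

end

theorem isParityRigid_graph [Fintype W] (hH : IsOddGraph H) (hD : D.IsAsymmetric) :
    IsParityRigid D.graph := by
  obtain ⟨hconn, hcard, hodd⟩ := hH
  rw [← Nat.card_eq_fintype_card] at hcard
  refine isParityRigid_of_singleton fun r hr u => ?_
  have hW := isSaturated_baseSet hodd hr
  rcases u with w | ⟨e, j⟩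
  · exact isSaturated_inl hD hconn hcard hr hW w
  · have := isSaturated_pathVertex hD hconn hcard hr hW e (j + 1) j.2
    rwa [D.pathVertex_succ j.2] at this

end Subdivision

end QAOA

theorem mainTheorem4 :
    (∀ {V W : Type*} [Fintype V] [DecidableEq V] [Fintype W]
        (G : SimpleGraph V) (H : SimpleGraph W),
        QAOA.IsOddGraph H → QAOA.IsAsymmetricSubdivision G H → QAOA.IsFree G) ∧
      (∀ n : ℕ, 3 ≤ n →
        QAOA.IsFree (QAOA.extendedLadder n 1) ∧ QAOA.IsFree (QAOA.extendedLadder n 2)) ∧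
      (∀ w h : ℕ, 3 ≤ h → h < w → QAOA.IsFree (QAOA.gridPlusOne w h)) := by
  refine ⟨?_, fun n hn => ⟨?_, ?_⟩, fun w h hh hw => ?_⟩
  · rintro V W _ _ _ G H hH ⟨D, hD, ⟨φ⟩⟩
    exact ((QAOA.Subdivision.isParityRigid_graph hH hD).of_iso φ).isFree
  · exact (QAOA.isParityRigid_extendedLadder hn (Or.inl rfl)).isFree
  · exact (QAOA.isParityRigid_extendedLadder hn (Or.inr rfl)).isFree
  · exact (QAOA.isParityRigid_gridPlusOne hh hw).isFree
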